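/- Let $\Omega$ be a finite non-empty set of basis states, $G$ a group of permutations of $\Omega$ whose natural action is regular (simply transitive), $P_\sigma|x\rangle=|\sigma x\rangle$ for $\sigma\in G$, and let $H=\sum_{\sigma\in G}D_\sigma P_\sigma$ be a Hermitian matrix on $\mathbb C^\Omega$ with all $D_\sigma$ diagonal. Write $D_0=H_{\rm diag}$ for the diagonal matrix $D_\sigma$ with $\sigma$ the identity permutation, $H_{\rm offdiag}=H-D_0$, and let $\beta>0$, $\langle A\rangle=\mathrm{Tr}[Ae^{-\beta H}]/\mathrm{Tr}[e^{-\beta H}]$. For a holomorphic $f$, the divided difference is $f[x_0,\dots,x_q]=\frac1{2\pi i}\oint_\Gamma \frac{f(x)}{\prod_i(x-x_i)}dx$, with $\Gamma$ a positively oriented circle about $0$ enclosing all $x_i$; $e^{-\beta[x_0,\dots,x_q]}$ and $[x_0,\dots,x_q]^k$ denote those of $e^{-\beta x}$ and $x^k$, and explicitly $[x_0,\dots,x_q]^{q+m}=\sum_{\kappa_0+\dots+\kappa_q=m}\prod_i x_i^{\kappa_i}$ for $m\ge0$. A configuration $\mathcal C=(z,(\sigma_1,\dots,\sigma_q))$,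 $q\ge 0$, consists of $z\in\Omega$ and non-identity elements $\sigma_k\in G$ with $\sigma_q\cdots\sigma_1=1$. Put $z_0=z$, $z_k=\sigma_k\cdots\sigma_1 z$, $E_{z_k}=\langle z_k|D_0|z_k\rangle$, $D_{\mathcal C}=\prod_{k=1}^q\langle z_k|D_{\sigma_k}|z_k\rangle$, $w_{\mathcal C}=D_{\mathcal C}\,e^{-\beta[E_{z_0},\dots,E_{z_q}]}$ and $R_j=e^{-\beta[E_{z_0},\dots,E_{z_j}]}/e^{-\beta[E_{z_0},\dots,E_{z_q}]}$ for $0\le j\le q$. A function $A_{\mathcal C}$ of configurations is an (unbiased) estimator of $\langle A\rangle$, written $A_{\mathcal C}\mathrel{\widehat=}\langle A\rangle$, if $\langle A\rangle=\sum_{\mathcal C}w_{\mathcal C}A_{\mathcal C}\big/\sum_{\mathcal C}w_{\mathcal C}$, where both sums over all configurations converge absolutely and the denominator is non-zero. Then $\sum_{\mathcal C}w_{\mathcal C}=\mathrm{Tr}[e^{-\beta H}]\neq0$ (absolutely convergent), $e^{-\beta[E_{z_0},\dots,E_{z_q}]}\ne0$ for every configuration, and the following hold. 1. Let $r>\max_{x}\sum_y|H_{xy}|$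 and let $g$ be analytic on a neighbourhood of the closed disc $|x|\le r$ (for an entire function $g$, any such $r$ may be taken). Then $g(H)=\sum_n\frac{g^{(n)}(0)}{n!}H^n$ converges, $$\mathrm{Tr}[g(H)e^{-\beta H}]=\sum_{\mathcal C}D_{\mathcal C}\sum_{j=0}^q g[E_{z_j},\dots,E_{z_q}]\,e^{-\beta[E_{z_0},\dots,E_{z_j}]}$$ with absolute convergence of the sum over $\mathcal C$, and $$(g(H))_{\mathcal C}=\sum_{j=0}^q g[E_{z_j},\dots,E_{z_q}]\,R_j\mathrel{\widehat=}\langle g(H)\rangle ,$$ where the divided differences of $g$ are taken along $|x|=r$. 2. $(H)_{\mathcal C}=E_{z_q}+\mathbf 1_{q\ge1}R_{q-1}\mathrel{\widehat=}\langle H\rangle$. 3. For every integer $k\ge0$, $(H^k)_{\mathcal C}=\sum_{j=\max\{0,q-k\}}^{q}[E_{z_j},\dots,E_{z_q}]^k R_j\mathrel{\widehat=}\langle H^k\rangle$. In particular $$(H^2)_{\mathcal C}=E_{z_q}^2+\mathbf 1_{q\ge1}(E_{z_q}+E_{z_{q-1}})R_{q-1}+\mathbf 1_{q\ge2}R_{q-2}\mathrel{\widehat=}\langle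 H^2\rangle,$$ $$(H^3)_{\mathcal C}=E_{z_q}^3+\mathbf 1_{q\ge1}(E_{z_q}^2+E_{z_q}E_{z_{q-1}}+E_{z_{q-1}}^2)R_{q-1}+\mathbf 1_{q\ge2}(E_{z_q}+E_{z_{q-1}}+E_{z_{q-2}})R_{q-2}+\mathbf 1_{q\ge3}R_{q-3}\mathrel{\widehat=}\langle H^3\rangle.$$ 4. $(H_{\rm offdiag})_{\mathcal C}=\mathbf 1_{q\ge1}R_{q-1}\mathrel{\widehat=}\langle H_{\rm offdiag}\rangle$. 5. $(H_{\rm offdiag}^2)_{\mathcal C}=(H^2)_{\mathcal C}+E_{z_q}\bigl(E_{z_q}-2(H)_{\mathcal C}\bigr)\mathrel{\widehat=}\langle H_{\rm offdiag}^2\rangle$. -/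

import Mathlib

namespace PMR

open scoped Real

/-- The divided difference `f[x₀, …, x_q]` over the multiset of nodes `xs`, as the contour integral
`(2πi)⁻¹ ∮ f(x) / ∏ᵢ (x - xᵢ) dx` over the positively oriented circle `|x| = r`. It is meant for
`f` holomorphic near the closed disc `|x| ≤ r` and nodes in the open disc. -/
noncomputable def dividedDifference (r : ℝ) (f : ℂ → ℂ) (xs : Multiset ℂ) : ℂ :=
  (2 * π * Complex.I)⁻¹ * ∮ x in C(0, r), f x / (xs.map fun xi => x - xi).prod

/-- The divided difference `e^{t[x₀, …, x_q]}` of the entire function `x ↦ e^{tx}`; the circle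
of radius `1 + ∑ |xᵢ|` encloses all nodes. -/
noncomputable def dde (t : ℝ) (xs : Multiset ℂ) : ℂ :=
  dividedDifference (1 + (xs.map fun xi => ‖xi‖).sum) (fun x => Complex.exp (t * x)) xs

/-- The matrix of a permutation in the column convention: `P_σ |x⟩ = |σ x⟩`. -/
def permMat {Ω : Type*} [DecidableEq Ω] (σ : Equiv.Perm Ω) : Matrix Ω Ω ℂ :=
  Matrix.of fun y x => if σ x = y then 1 else 0

/-- The natural action of the permutation group `G` is regular (simply transitive). -/
def HasRegularAction {Ω : Type*} (G : Subgroup (Equiv.Perm Ω)) : Prop :=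
  (∀ x y : Ω, ∃ σ ∈ G, σ x = y) ∧ ∀ σ ∈ G, ∀ x : Ω, σ x = x → σ = 1

/-- `A = ∑_{σ ∈ G} D_σ P_σ` is a permutation matrix representation of `A`: the group `G` acts
regularly and `D σ` is the vector of diagonal entries of the diagonal matrix `D_σ`. -/
def IsPMRForm {Ω : Type*} [Fintype Ω] [DecidableEq Ω] (G : Subgroup (Equiv.Perm Ω)) [Fintype G]
    (D : G → Ω → ℂ) (A : Matrix Ω Ω ℂ) : Prop :=
  HasRegularAction G ∧ A = ∑ σ : G, Matrix.diagonal (D σ) * permMat (σ : Equiv.Perm Ω)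

/-- A configuration `(z, S)`: a basis state `z` and a sequence `seq = [σ_{i_1}, …, σ_{i_q}]` of
non-identity elements of `G` whose operator product `S = P_{i_q} ⋯ P_{i_1}` is the identity. -/
structure Config {Ω : Type*} (G : Subgroup (Equiv.Perm Ω)) where
  z : Ω
  seq : List G
  ne_one : ∀ σ ∈ seq, σ ≠ 1
  closed : seq.reverse.prod = 1

namespace Config

variable {Ω : Type*} {G : Subgroup (Equiv.Perm Ω)}

/-- The expansion order `q`. -/
def q (c : Config G) : ℕ := c.seq.length

/-- The state `z_k = P_{i_k} ⋯ P_{i_1} z`, with `z_0 = z`. -/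
def state (c : Config G) (k : ℕ) : Ω :=
  ((c.seq.take k).reverse.prod : Equiv.Perm Ω) c.z

/-- The diagonal energy `E_{z_k} = ⟨z_k| D_0 |z_k⟩`, where `D_0` is the diagonal matrix that
multiplies the identity permutation. -/
def energy (D : G → Ω → ℂ) (c : Config G) (k : ℕ) : ℂ := D 1 (c.state k)

/-- The multiset of energies `[E_{z_a}, …, E_{z_b}]`. -/
def energies (D : G → Ω → ℂ) (c : Config G) (a b : ℕ) : Multiset ℂ :=
  (Finset.Icc a b).val.map (c.energy D)

/-- The off-diagonal hopping strength `∏_{k=1}^q ⟨z_k| D_{i_k} |z_k⟩`. -/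
def hopping (D : G → Ω → ℂ) (c : Config G) : ℂ :=
  ∏ k : Fin c.seq.length, D (c.seq.get k) (c.state (k + 1))

/-- `e^{-β[E_{z_a}, …, E_{z_b}]}`. -/
noncomputable def boltz (β : ℝ) (D : G → Ω → ℂ) (c : Config G) (a b : ℕ) : ℂ :=
  dde (-β) (c.energies D a b)

/-- The ratio `e^{-β[E_{z_0}, …, E_{z_j}]} / e^{-β[E_{z_0}, …, E_{z_q}]}`. -/
noncomputable def ratio (β : ℝ) (D : G → Ω → ℂ) (c : Config G) (j : ℕ) : ℂ :=
  c.boltz β D 0 j / c.boltz β D 0 c.q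

/-- The generalized Boltzmann weight `w_C`. -/
noncomputable def weight (β : ℝ) (D : G → Ω → ℂ) (c : Config G) : ℂ :=
  c.hopping D * c.boltz β D 0 c.q

/-- `[E_{z_j}, …, E_{z_q}]^{q-j+m}` in closed form: the sum of the products
`E_{z_j}^{κ_j} ⋯ E_{z_q}^{κ_q}` over all `κ_j, …, κ_q ≥ 0` with sum `m`. -/
def homogeneous (D : G → Ω → ℂ) (c : Config G) (j m : ℕ) : ℂ :=
  ∑ κ ∈ (Finset.Icc j c.q).piAntidiag m, ∏ i ∈ Finset.Icc j c.q, c.energy D i ^ κ i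

/-- `(g(H))_C`, with the divided differences of `g` taken along the circle of radius `r`. -/
noncomputable def estFun (β : ℝ) (D : G → Ω → ℂ) (r : ℝ) (g : ℂ → ℂ) (c : Config G) : ℂ :=
  ∑ j ∈ Finset.range (c.q + 1), dividedDifference r g (c.energies D j c.q) * c.ratio β D j

/-- `(H)_C`. -/
noncomputable def estH (β : ℝ) (D : G → Ω → ℂ) (c : Config G) : ℂ :=
  c.energy D c.q + if 1 ≤ c.q then c.ratio β D (c.q - 1) else 0

/-- `(H^k)_C`. The sum is over `max{0, q - k} ≤ j ≤ q`. -/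
noncomputable def estPow (β : ℝ) (D : G → Ω → ℂ) (k : ℕ) (c : Config G) : ℂ :=
  ∑ j ∈ Finset.Icc (c.q - k) c.q, c.homogeneous D j (k - (c.q - j)) * c.ratio β D j

/-- `(H^2)_C`, written out. -/
noncomputable def estSq (β : ℝ) (D : G → Ω → ℂ) (c : Config G) : ℂ :=
  c.energy D c.q ^ 2
    + (if 1 ≤ c.q then
        (c.energy D c.q + c.energy D (c.q - 1)) * c.ratio β D (c.q - 1) else 0)
    + (if 2 ≤ c.q then c.ratio β D (c.q - 2) else 0)

/-- `(H^3)_C`, written out. -/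
noncomputable def estCube (β : ℝ) (D : G → Ω → ℂ) (c : Config G) : ℂ :=
  c.energy D c.q ^ 3
    + (if 1 ≤ c.q then
        (c.energy D c.q ^ 2 + c.energy D c.q * c.energy D (c.q - 1)
          + c.energy D (c.q - 1) ^ 2) * c.ratio β D (c.q - 1) else 0)
    + (if 2 ≤ c.q then
        (c.energy D c.q + c.energy D (c.q - 1) + c.energy D (c.q - 2))
          * c.ratio β D (c.q - 2) else 0)
    + (if 3 ≤ c.q then c.ratio β D (c.q - 3) else 0)

/-- `(H_offdiag)_C`. -/
noncomputable def estOff (β : ℝ) (D : G → Ω → ℂ) (c : Config G) : ℂ :=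
  if 1 ≤ c.q then c.ratio β D (c.q - 1) else 0

/-- `(H_offdiag^2)_C`. -/
noncomputable def estOffSq (β : ℝ) (D : G → Ω → ℂ) (c : Config G) : ℂ :=
  c.estSq β D + c.energy D c.q * (c.energy D c.q - 2 * c.estH β D)

end Config

/-- The Gibbs operator `e^{-βH}`. -/
noncomputable def gibbs {Ω : Type*} [Fintype Ω] [DecidableEq Ω] (β : ℝ) (H : Matrix Ω Ω ℂ) :
    Matrix Ω Ω ℂ :=
  NormedSpace.exp (-(β : ℂ) • H)

/-- The thermal expectation value `⟨A⟩ = Tr[A e^{-βH}] / Tr[e^{-βH}]`. -/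
noncomputable def thermal {Ω : Type*} [Fintype Ω] [DecidableEq Ω] (β : ℝ) (H A : Matrix Ω Ω ℂ) :
    ℂ :=
  (A * gibbs β H).trace / (gibbs β H).trace

/-- The terms `g⁽ⁿ⁾(0)/n! • Hⁿ` of the Taylor expansion of `g(H)`. -/
noncomputable def taylorTerm {Ω : Type*} [Fintype Ω] [DecidableEq Ω] (g : ℂ → ℂ)
    (H : Matrix Ω Ω ℂ) (n : ℕ) : Matrix Ω Ω ℂ :=
  (iteratedDeriv n g 0 / (n.factorial : ℂ)) • H ^ n

/-- The analytic function `g(H)` of the matrix `H`, by Taylor expansion about `0`. -/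
noncomputable def matFun {Ω : Type*} [Fintype Ω] [DecidableEq Ω] (g : ℂ → ℂ)
    (H : Matrix Ω Ω ℂ) : Matrix Ω Ω ℂ :=
  ∑' n : ℕ, taylorTerm g H n

/-- `est` is an (unbiased) estimator of `⟨A⟩`:
`⟨A⟩ = (∑_C w_C est(C)) / (∑_C w_C)`, where both sums over all configurations converge absolutely
and the denominator does not vanish. -/
def IsEstimator {Ω : Type*} [Fintype Ω] [DecidableEq Ω] {G : Subgroup (Equiv.Perm Ω)}
    (β : ℝ) (D : G → Ω → ℂ) (H A : Matrix Ω Ω ℂ) (est : Config G → ℂ) : Prop :=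
  (Summable fun c : Config G => c.weight β D) ∧
  (Summable fun c : Config G => c.weight β D * est c) ∧
  (∑' c : Config G, c.weight β D) ≠ 0 ∧
  thermal β H A = (∑' c : Config G, c.weight β D * est c) / ∑' c : Config G, c.weight β D

end PMR

namespace PMR

open Metric

/-! Let `r` exceed all row sums of `|H|`. On `|x| = r` the resolvent `(x - H)⁻¹` is an absolutely
convergent sum over walks, with a factor `(x - E)⁻¹` per visited state and a hopping factor per step
(`IsPMRForm.walkSum_mul`). The action is regular, so closed walks without identity steps are exactly
the configurations. Multiplying by `f` and integrating over the circle turns the walk of a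
configuration into its hopping times `f[E_{z_0}, …, E_{z_q}]`, while diagonalization and Cauchy's
formula turn the resolvent into `f(H)`: this is `IsPMRForm.hasSum_hopping_mul_dividedDifference`.

For `f = g · e^{-βx}` the Leibniz rule `dividedDifference_mul` yields the sum over `j`. Dividing by
the Boltzmann factor is legitimate by `dividedDifference_exp_ne_zero`: at real nodes the exponential
series, suitably shifted, has terms of one sign. Powers follow from `dividedDifference_pow`.

The trace expansion carries an arbitrary diagonal matrix `diagonal w`, which multiplies each term by
`w z`. Since `z_q = z`, this accounts for the factors `E_{z_q}` in the off-diagonal estimators. -/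

theorem hasSum_circleIntegral_of_dominated {ι : Type*} [Countable ι] {r : ℝ} (hr : 0 ≤ r)
    {F : ι → ℂ → ℂ} {f : ℂ → ℂ} {b : ι → ℝ} (hF : ∀ i, ContinuousOn (F i) (sphere 0 r))
    (hb : ∀ i, ∀ x ∈ sphere (0 : ℂ) r, ‖F i x‖ ≤ b i) (hs : Summable b)
    (hf : ∀ x ∈ sphere (0 : ℂ) r, HasSum (fun i => F i x) (f x)) :
    HasSum (fun i => ∮ x in C(0, r), F i x) (∮ x in C(0, r), f x) := by
  have hm : ∀ θ : ℝ, circleMap 0 r θ ∈ sphere (0 : ℂ) r := fun θ => circleMap_mem_sphere 0 hr θ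
  -- Dominated convergence in the angle; the factor `r` is the speed of the circle parametrization.
  refine intervalIntegral.hasSum_integral_of_dominated_convergence (fun i _ => r * b i) ?_ ?_ ?_ ?_ ?_
  · intro i
    have h : Continuous fun θ : ℝ => deriv (circleMap 0 r) θ • F i (circleMap 0 r θ) := by
      simp only [deriv_circleMap]
      exact ((continuous_circleMap 0 r).mul continuous_const).smul
        ((hF i).comp_continuous (continuous_circleMap 0 r) hm)
    exact h.aestronglyMeasurable
  · intro i
    refine Filter.Eventually.of_forall fun θ _ => ?_
    rw [norm_smul, deriv_circleMap]
    simp only [norm_mul, norm_circleMap_zero, Complex.norm_I, mul_one, abs_of_nonneg hr]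
    exact mul_le_mul_of_nonneg_left (hb i _ (hm θ)) hr
  · exact Filter.Eventually.of_forall fun θ _ => hs.mul_left r
  · exact intervalIntegrable_const
  · exact Filter.Eventually.of_forall fun θ _ => (hf _ (hm θ)).const_smul _

/-! ### Divided differences as contour integrals -/

section DividedDifference

variable {r : ℝ} {xs : Multiset ℂ} {a : ℂ} {f g h : ℂ → ℂ}

theorem sub_ne_zero_of_mem_sphere {x : ℂ} (hx : x ∈ sphere (0 : ℂ) r) (ha : ‖a‖ < r) :
    x - a ≠ 0 := by
  rintro h
  rw [mem_sphere_zero_iff_norm, sub_eq_zero.1 h] at hx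
  exact ha.ne hx

theorem prod_sub_ne_zero {x : ℂ} (hx : ∀ a ∈ xs, x - a ≠ 0) :
    (xs.map fun a => x - a).prod ≠ 0 := by
  rw [Ne, Multiset.prod_eq_zero_iff, Multiset.mem_map]
  rintro ⟨a, ha, h⟩
  exact hx a ha h

theorem continuous_prod_sub (xs : Multiset ℂ) :
    Continuous fun x : ℂ => (xs.map fun a => x - a).prod := by
  induction xs using Multiset.induction with
  | empty => simpa using continuous_const
  | cons a s ih =>
    simp only [Multiset.map_cons, Multiset.prod_cons]
    exact (continuous_id.sub continuous_const).mul ih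

theorem differentiable_prod_sub (xs : Multiset ℂ) :
    Differentiable ℂ fun x : ℂ => (xs.map fun a => x - a).prod := by
  induction xs using Multiset.induction with
  | empty => simp
  | cons a s ih =>
    simp only [Multiset.map_cons, Multiset.prod_cons]
    exact (differentiable_id.sub_const a).mul ih

theorem continuousOn_div_prod_sub (hxs : ∀ a ∈ xs, ‖a‖ < r) (hf : ContinuousOn f (sphere 0 r)) :
    ContinuousOn (fun x => f x / (xs.map fun a => x - a).prod) (sphere 0 r) :=
  hf.div (continuous_prod_sub xs).continuousOn fun _ hx =>
    prod_sub_ne_zero fun a ha => sub_ne_zero_of_mem_sphere hx (hxs a ha)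

theorem dividedDifference_congr (hr : 0 ≤ r) (hfg : ∀ x ∈ sphere (0 : ℂ) r, f x = g x) :
    dividedDifference r f xs = dividedDifference r g xs := by
  unfold dividedDifference
  rw [circleIntegral.integral_congr hr]
  intro x hx
  simp only [hfg x hx]

theorem dividedDifference_add (hr : 0 ≤ r) (hxs : ∀ a ∈ xs, ‖a‖ < r)
    (hf : ContinuousOn f (sphere 0 r)) (hg : ContinuousOn g (sphere 0 r)) :
    dividedDifference r (fun x => f x + g x) xs =
      dividedDifference r f xs + dividedDifference r g xs := by
  unfold dividedDifference
  rw [← mul_add, ← circleIntegral.integral_add]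
  · simp only [add_div]
  · exact (continuousOn_div_prod_sub hxs hf).circleIntegrable hr
  · exact (continuousOn_div_prod_sub hxs hg).circleIntegrable hr

theorem dividedDifference_const_mul (c : ℂ) :
    dividedDifference r (fun x => c * f x) xs = c * dividedDifference r f xs := by
  unfold dividedDifference
  simp only [mul_div_assoc]
  rw [circleIntegral.integral_const_mul]
  ring

theorem dividedDifference_cons_sub_mul (hr : 0 ≤ r) (ha : ‖a‖ < r) :
    dividedDifference r (fun x => (x - a) * f x) (a ::ₘ xs) = dividedDifference r f xs := by
  unfold dividedDifference
  rw [circleIntegral.integral_congr hr]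
  intro x hx
  simp only [Multiset.map_cons, Multiset.prod_cons]
  rw [mul_div_mul_left _ _ (sub_ne_zero_of_mem_sphere hx ha)]

theorem dividedDifference_singleton (ha : ‖a‖ < r) (hf : DifferentiableOn ℂ f (closedBall 0 r)) :
    dividedDifference r f {a} = f a := by
  have := (hf.mono closure_ball_subset_closedBall).diffContOnCl.two_pi_i_inv_smul_circleIntegral_sub_inv_smul
    (w := a) (by simpa using ha)
  unfold dividedDifference
  simpa [div_eq_inv_mul] using this

/-- The recursion of divided differences of a product with an affine function. -/
theorem dividedDifference_cons_affine_mul (hr : 0 ≤ r) (ha : ‖a‖ < r) (hxs : ∀ a ∈ xs, ‖a‖ < r)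
    (hf : ContinuousOn f (sphere 0 r)) (s t : ℂ) :
    dividedDifference r (fun x => (s * x + t) * f x) (a ::ₘ xs) =
      (s * a + t) * dividedDifference r f (a ::ₘ xs) + s * dividedDifference r f xs := by
  rw [← dividedDifference_cons_sub_mul hr ha (f := f) (xs := xs), ← dividedDifference_const_mul,
    ← dividedDifference_const_mul, ← dividedDifference_add hr (by simpa using ⟨ha, hxs⟩)]
  · exact dividedDifference_congr hr fun x _ => by ring
  · fun_prop
  · fun_prop

/-- If all nodes coincide, the integrand is `(x - a)⁻ⁿ` with `n ≥ 2`, which has a primitive. For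
distinct nodes `a`, `b`, the affine recursion expresses `(a - b)` times the divided difference as
the difference of those with `b` or `a` removed. These agree: both are `1` if no other node is left,
and both vanish by induction otherwise. -/
theorem dividedDifference_one (hr : 0 ≤ r) (hxs : ∀ a ∈ xs, ‖a‖ < r) (h2 : 2 ≤ xs.card) :
    dividedDifference r (fun _ => 1) xs = 0 := by
  induction hn : xs.card using Nat.strong_induction_on generalizing xs with
  | _ n ih =>
  obtain ⟨a, ha⟩ := Multiset.card_pos_iff_exists_mem.1 (by omega : 0 < xs.card)
  by_cases hall : ∀ b ∈ xs, b = a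
  · rw [Multiset.eq_replicate_of_mem hall]
    unfold dividedDifference
    simp only [Multiset.map_replicate, Multiset.prod_replicate]
    have := circleIntegral.integral_sub_zpow_of_ne (n := -(xs.card : ℤ)) (by omega) 0 a r
    simp only [zpow_neg, zpow_natCast] at this
    simp [one_div, this]
  · push Not at hall
    obtain ⟨b, hb, hba⟩ := hall
    obtain ⟨ys, rfl⟩ := Multiset.exists_cons_of_mem ha
    obtain ⟨zs, rfl⟩ := Multiset.exists_cons_of_mem ((Multiset.mem_cons.1 hb).resolve_left hba)
    have har : ‖a‖ < r := hxs a (by simp)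
    have hbr : ‖b‖ < r := hxs b (by simp)
    have hzs : ∀ c ∈ zs, ‖c‖ < r := fun c hc => hxs c (by simp [hc])
    have key := dividedDifference_cons_affine_mul (a := a) (xs := b ::ₘ zs) (f := fun _ => 1) hr har
      (by simpa using ⟨hbr, hzs⟩) continuousOn_const 1 (-b)
    have key2 := dividedDifference_cons_sub_mul (a := b) (xs := a ::ₘ zs) (f := fun _ => 1) hr hbr
    rw [Multiset.cons_swap] at key2
    simp only [one_mul, ← sub_eq_add_neg] at key
    rw [key2] at key
    have heq : dividedDifference r (fun _ => 1) (a ::ₘ zs) =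
        dividedDifference r (fun _ => 1) (b ::ₘ zs) := by
      rcases Multiset.empty_or_exists_mem zs with rfl | ⟨c, hc⟩
      · rw [Multiset.cons_zero, Multiset.cons_zero, dividedDifference_singleton har (by fun_prop),
          dividedDifference_singleton hbr (by fun_prop)]
      · have : 0 < zs.card := Multiset.card_pos_iff_exists_mem.2 ⟨c, hc⟩
        simp only [Multiset.card_cons] at hn
        rw [ih (zs.card + 1) (by omega) (by simpa using ⟨har, hzs⟩) (by simp; omega) (by simp),
          ih (zs.card + 1) (by omega) (by simpa using ⟨hbr, hzs⟩) (by simp; omega) (by simp)]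
    rw [heq] at key
    have h0 : (a - b) * dividedDifference r (fun _ => 1) (a ::ₘ b ::ₘ zs) = 0 := by
      linear_combination -key
    exact (mul_eq_zero.1 h0).resolve_left (sub_ne_zero.2 hba.symm)

/-- Cauchy's theorem on an annulus free of nodes. It moves `dde` from its node-dependent circle to
the common circle on which the resolvent is expanded. -/
theorem dividedDifference_radius {r' : ℝ} (hr : 0 < r) (hrr : r ≤ r') (hxs : ∀ a ∈ xs, ‖a‖ < r)
    (hf : Differentiable ℂ f) : dividedDifference r' f xs = dividedDifference r f xs := by
  unfold dividedDifference
  have hne : ∀ x : ℂ, r ≤ ‖x‖ → (xs.map fun a => x - a).prod ≠ 0 := fun x hx =>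
    prod_sub_ne_zero fun a ha h => by
      have := hxs a ha
      rw [← sub_eq_zero.1 h] at this
      linarith
  rw [Complex.circleIntegral_eq_of_differentiable_on_annulus_off_countable hr hrr
    Set.countable_empty]
  · intro x hx
    refine ContinuousAt.continuousWithinAt (hf.continuous.continuousAt.div
      (continuous_prod_sub xs).continuousAt (hne x ?_))
    simpa using hx.2
  · intro x hx
    refine (hf x).div (differentiable_prod_sub xs x) (hne x ?_)
    have := hx.1.2
    simp only [mem_closedBall, dist_zero_right, not_le] at this
    exact this.le

theorem dde_eq_dividedDifference (hr : 0 < r) (hxs : ∀ a ∈ xs, ‖a‖ < r) (t : ℝ) :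
    dde t xs = dividedDifference r (fun x => Complex.exp (t * x)) xs := by
  have hd : Differentiable ℂ fun x : ℂ => Complex.exp (t * x) := by fun_prop
  have hpos : 0 ≤ (xs.map fun a => ‖a‖).sum :=
    Multiset.sum_nonneg (by simp only [Multiset.mem_map]; rintro _ ⟨a, _, rfl⟩; exact norm_nonneg a)
  have hxs' : ∀ a ∈ xs, ‖a‖ < 1 + (xs.map fun a => ‖a‖).sum := fun a ha => by
    have : ‖a‖ ≤ (xs.map fun a => ‖a‖).sum :=
      Multiset.single_le_sum (by simp only [Multiset.mem_map]; rintro _ ⟨a, _, rfl⟩; exact norm_nonneg a)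
        _ (Multiset.mem_map_of_mem _ ha)
    linarith
  unfold dde
  rcases le_total r (1 + (xs.map fun a => ‖a‖).sum) with hle | hle
  · exact dividedDifference_radius hr hle hxs hd
  · exact (dividedDifference_radius (by linarith) hle hxs' hd).symm

theorem icc_map_cons (x : ℕ → ℂ) (q : ℕ) :
    (Finset.Icc 0 (q + 1)).val.map x = x 0 ::ₘ (Finset.Icc 0 q).val.map fun i => x (i + 1) := by
  have h : Finset.Icc 0 (q + 1) =
      Finset.cons 0 ((Finset.Icc 0 q).map (addRightEmbedding 1)) (by simp) := by
    ext i
    rcases i with _ | i <;> simp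
  rw [h, Finset.cons_val, Finset.map_val, Multiset.map_cons, Multiset.map_map]
  rfl

theorem icc_map_succ (x : ℕ → ℂ) (j q : ℕ) :
    (Finset.Icc (j + 1) (q + 1)).val.map x = (Finset.Icc j q).val.map fun i => x (i + 1) := by
  have h : Finset.Icc (j + 1) (q + 1) = (Finset.Icc j q).map (addRightEmbedding 1) := by
    ext i
    rcases i with _ | i <;> simp
  rw [h, Finset.map_val, Multiset.map_map]
  rfl

theorem differentiable_dslope (hh : Differentiable ℂ h) (a : ℂ) : Differentiable ℂ (dslope h a) :=
  differentiableOn_univ.1 ((Complex.differentiableOn_dslope Filter.univ_mem).2 hh.differentiableOn)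

/-- The Leibniz rule for divided differences. -/
theorem dividedDifference_mul (hr : 0 ≤ r) (hg : DifferentiableOn ℂ g (closedBall 0 r))
    (hh : Differentiable ℂ h) (q : ℕ) (x : ℕ → ℂ) (hx : ∀ i, ‖x i‖ < r) :
    dividedDifference r (fun y => g y * h y) ((Finset.Icc 0 q).val.map x) =
      ∑ j ∈ Finset.range (q + 1), dividedDifference r g ((Finset.Icc j q).val.map x) *
        dividedDifference r h ((Finset.Icc 0 j).val.map x) := by
  have hgc : ContinuousOn g (sphere 0 r) := hg.continuousOn.mono sphere_subset_closedBall
  induction q generalizing x h with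
  | zero =>
    have h0 : (Finset.Icc 0 0).val.map x = {x 0} := by simp
    simp only [zero_add, Finset.range_one, Finset.sum_singleton, h0]
    rw [dividedDifference_singleton (hx 0) hg, dividedDifference_singleton (hx 0)
      hh.differentiableOn, dividedDifference_singleton (f := fun y => g y * h y) (hx 0)
        (hg.mul hh.differentiableOn)]
  | succ q ih =>
    -- Write `h y = h (x 0) + (y - x 0) * h1 y`. The constant gives the term `j = 0`; the factor `y
    -- - x 0` cancels the first node, and induction applies to `g * h1` on the remaining ones.
    set h1 := dslope h (x 0) with hh1
    have hd : Differentiable ℂ h1 := differentiable_dslope hh _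
    have hsplit : ∀ y, h y = h (x 0) + (y - x 0) * h1 y := fun y => by
      have := sub_smul_dslope h (x 0) y
      rw [smul_eq_mul] at this
      rw [hh1, this]; ring
    have hm : ∀ (a b : ℕ) (y : ℕ → ℂ), (∀ i, ‖y i‖ < r) →
        ∀ z ∈ (Finset.Icc a b).val.map y, ‖z‖ < r := by
      intro a b y hy z hz
      obtain ⟨i, _, rfl⟩ := Multiset.mem_map.1 hz
      exact hy i
    rw [Finset.sum_range_succ']
    have hL : dividedDifference r (fun y => g y * h y) ((Finset.Icc 0 (q + 1)).val.map x) =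
        h (x 0) * dividedDifference r g ((Finset.Icc 0 (q + 1)).val.map x) +
          dividedDifference r (fun y => g y * h1 y)
            ((Finset.Icc 0 q).val.map fun i => x (i + 1)) := by
      rw [← dividedDifference_cons_sub_mul (f := fun y => g y * h1 y) hr (hx 0), ← icc_map_cons,
        ← dividedDifference_const_mul, ← dividedDifference_add hr (hm _ _ _ hx)]
      · exact dividedDifference_congr hr fun y _ => by rw [hsplit y]; ring
      · exact continuousOn_const.mul hgc
      · exact (continuous_id.sub continuous_const).continuousOn.mul
          (hgc.mul hd.continuous.continuousOn)
    have h0 : (Finset.Icc 0 0).val.map x = {x 0} := by simp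
    rw [hL, ih hd _ fun i => hx (i + 1), h0, dividedDifference_singleton (hx 0)
      hh.differentiableOn, add_comm, mul_comm (h (x 0))]
    congr 1
    refine Finset.sum_congr rfl fun j _ => ?_
    rw [icc_map_succ, icc_map_cons, ← dividedDifference_cons_sub_mul (f := h1) hr (hx 0), ← icc_map_cons]
    congr 1
    -- With at least two nodes the constant `h (x 0)` does not contribute.
    have : dividedDifference r (fun y => (y - x 0) * h1 y + h (x 0) * 1)
        ((Finset.Icc 0 (j + 1)).val.map x) =
        dividedDifference r (fun y => (y - x 0) * h1 y) ((Finset.Icc 0 (j + 1)).val.map x) := by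
      rw [dividedDifference_add hr (hm _ _ _ hx), dividedDifference_const_mul,
        dividedDifference_one hr (hm _ _ _ hx), mul_zero, add_zero]
      · simp
      · exact ((continuous_id.sub continuous_const).mul hd.continuous).continuousOn
      · exact continuousOn_const
    rw [← this]
    exact dividedDifference_congr hr fun y _ => by rw [hsplit y]; ring

/-- The affine recursion with slope `-β` adds `u ≥ 0` times the value at the lower exponent to `-β`
times the value with one node fewer, so after removal of the power of `-β` everything stays
nonnegative. When `n + 1` is the number of nodes, the second summand descends to `u ^ 0 = 1` at a
single node, whence strict positivity. -/
theorem dividedDifference_affine_pow (hr : 0 ≤ r) (β : ℝ) (t : ℝ)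
    (hxs : ∀ a ∈ xs, ‖a‖ < r) (hreal : ∀ a ∈ xs, ∃ u : ℝ, 0 ≤ u ∧ -(β : ℂ) * a + t = u)
    (h0 : xs ≠ 0) (n : ℕ) :
    ∃ p : ℝ, 0 ≤ p ∧ (n + 1 = xs.card → 0 < p) ∧
      dividedDifference r (fun x => (-(β : ℂ) * x + t) ^ n) xs = (-(β : ℂ)) ^ (xs.card - 1) * p := by
  induction xs using Multiset.induction generalizing n with
  | empty => exact absurd rfl h0
  | cons a ys ih =>
    obtain ⟨u, hu, hau⟩ := hreal a (by simp)
    have har : ‖a‖ < r := hxs a (by simp)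
    have hys : ∀ b ∈ ys, ‖b‖ < r := fun b hb => hxs b (by simp [hb])
    rcases eq_or_ne ys 0 with rfl | hne
    · refine ⟨u ^ n, by positivity, ?_, ?_⟩
      · intro hn
        have : n = 0 := by simpa using hn
        simp [this]
      · rw [Multiset.cons_zero, dividedDifference_singleton har (by fun_prop), hau]
        simp
    · have hc : 0 < ys.card := Multiset.card_pos.2 hne
      induction n with
      | zero =>
        refine ⟨0, le_rfl, ?_, ?_⟩
        · intro hn
          simp only [Multiset.card_cons] at hn
          omega
        · simp only [pow_zero]
          rw [dividedDifference_one hr hxs (by simp; omega)]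
          simp
      | succ n ihn =>
        obtain ⟨p, hp, -, hpe⟩ := ihn
        obtain ⟨p', hp', hpos, hpe'⟩ := ih hys (fun b hb => hreal b (by simp [hb])) hne n
        refine ⟨u * p + p', by positivity, ?_, ?_⟩
        · intro hn
          have := hpos (by simpa using hn)
          positivity
        · simp only [pow_succ' _ n]
          rw [dividedDifference_cons_affine_mul hr har hys (by fun_prop), hpe, hpe', hau]
          obtain ⟨m, hm⟩ : ∃ m, ys.card = m + 1 := ⟨ys.card - 1, by omega⟩
          simp only [Multiset.card_cons, hm, Nat.add_sub_cancel]
          push_cast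
          ring

/-- Divided differences of the exponential over real nodes do not vanish. -/
theorem dividedDifference_exp_ne_zero {β : ℝ} (hβ : 0 < β) (hxs : ∀ a ∈ xs, ‖a‖ < r)
    (hreal : ∀ a ∈ xs, ∃ u : ℝ, a = u) (h0 : xs ≠ 0) :
    dividedDifference r (fun x => Complex.exp (((-β : ℝ) : ℂ) * x)) xs ≠ 0 := by
  obtain ⟨b, hb⟩ := Multiset.exists_mem_of_ne_zero h0
  have hr : 0 < r := (norm_nonneg b).trans_lt (hxs b hb)
  -- This shift makes `-β a + t = β (r - a)` nonnegative at every real node, at the price of the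
  -- nonzero factor `e^t`.
  set t : ℝ := β * r with ht
  have hu : ∀ a ∈ xs, ∃ u : ℝ, 0 ≤ u ∧ -(β : ℂ) * a + t = u := by
    intro a ha
    obtain ⟨u, rfl⟩ := hreal a ha
    refine ⟨β * (r - u), ?_, by push_cast [ht]; ring⟩
    have := hxs _ ha
    rw [Complex.norm_real, Real.norm_eq_abs] at this
    have := le_abs_self u
    exact mul_nonneg hβ.le (by linarith)
  choose p hp0 hppos hpe using dividedDifference_affine_pow hr.le β t hxs hu h0
  have hcont : ∀ n : ℕ, ContinuousOn (fun x : ℂ => ((n.factorial : ℂ))⁻¹ * (-(β : ℂ) * x + t) ^ n)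
      (sphere 0 r) := fun n => by fun_prop
  obtain ⟨δ, hδ, hδle⟩ : ∃ δ > 0, ∀ x ∈ sphere (0 : ℂ) r, δ ≤ ‖(xs.map fun a => x - a).prod‖ := by
    have hne : (sphere (0 : ℂ) r).Nonempty := NormedSpace.sphere_nonempty.2 hr.le
    obtain ⟨x0, hx0, hmin⟩ := (isCompact_sphere (0 : ℂ) r).exists_isMinOn hne
      (continuous_prod_sub xs).norm.continuousOn
    exact ⟨_, norm_pos_iff.2 (prod_sub_ne_zero fun a ha =>
      sub_ne_zero_of_mem_sphere hx0 (hxs a ha)), fun x hx => hmin hx⟩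
  have hsum : HasSum
      (fun n : ℕ => dividedDifference r (fun x => ((n.factorial : ℂ))⁻¹ * (-(β : ℂ) * x + t) ^ n) xs)
      (dividedDifference r (fun x => Complex.exp (-(β : ℂ) * x + t)) xs) := by
    -- On the circle `|-β x + t| ≤ 2 β r`, and `δ` bounds the node polynomial from below.
    refine HasSum.mul_left _ (hasSum_circleIntegral_of_dominated hr.le
      (b := fun n : ℕ => ((2 * (β * r)) ^ n / n.factorial) / δ)
      (fun n => continuousOn_div_prod_sub hxs (hcont n)) ?_ ?_ ?_)
    · intro n x hx
      rw [norm_div, norm_mul, norm_inv, norm_pow, Complex.norm_natCast, ← div_eq_inv_mul]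
      have h1 : ‖-(β : ℂ) * x + t‖ ≤ 2 * (β * r) := by
        refine (norm_add_le _ _).trans ?_
        rw [mem_sphere_zero_iff_norm] at hx
        rw [norm_mul, norm_neg, hx, Complex.norm_real, Complex.norm_real, Real.norm_eq_abs,
          Real.norm_eq_abs, abs_of_pos hβ, ht, abs_of_pos (by positivity)]
        linarith
      have := hδle x hx
      gcongr
    · exact (Real.summable_pow_div_factorial _).div_const _
    · intro x hx
      refine HasSum.div_const ?_ _
      have := NormedSpace.exp_series_hasSum_exp' (𝕂 := ℂ) (-(β : ℂ) * x + t)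
      rw [← Complex.exp_eq_exp_ℂ] at this
      simpa using this
  have hterm : ∀ n : ℕ,
      dividedDifference r (fun x => ((n.factorial : ℂ))⁻¹ * (-(β : ℂ) * x + t) ^ n) xs =
        (-(β : ℂ)) ^ (xs.card - 1) * ((p n / n.factorial : ℝ) : ℂ) := fun n => by
    rw [dividedDifference_const_mul, hpe]
    push_cast
    ring
  simp only [hterm] at hsum
  have hβ0 : (-(β : ℂ)) ^ (xs.card - 1) ≠ 0 :=
    pow_ne_zero _ (neg_ne_zero.2 (by exact_mod_cast hβ.ne'))
  have hS : Summable fun n : ℕ => p n / n.factorial := by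
    have := (summable_mul_left_iff hβ0).1 hsum.summable
    exact Complex.summable_ofReal.1 this
  have hpos : 0 < ∑' n : ℕ, p n / n.factorial := by
    -- The exponent one less than the number of nodes supplies the strictly positive term.
    refine hS.tsum_pos (fun n => div_nonneg (hp0 n) (by positivity)) (xs.card - 1) ?_
    have hc : 0 < xs.card := Multiset.card_pos.2 h0
    exact div_pos (hppos _ (by omega)) (by positivity)
  have hval := hsum.unique ((Complex.hasSum_ofReal.2 hS.hasSum).mul_left _)
  have hexp : dividedDifference r (fun x => Complex.exp (-(β : ℂ) * x + t)) xs =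
      Complex.exp t * dividedDifference r (fun x => Complex.exp (((-β : ℝ) : ℂ) * x)) xs := by
    rw [← dividedDifference_const_mul]
    refine dividedDifference_congr hr.le fun x _ => ?_
    rw [Complex.exp_add, mul_comm]
    push_cast
    rfl
  intro hz
  rw [hexp, hz, mul_zero] at hval
  exact mul_ne_zero hβ0 (Complex.ofReal_ne_zero.2 hpos.ne') hval.symm

end DividedDifference

end PMR

namespace PMR

open Metric

/-! ### Complete homogeneous polynomials and divided differences of powers -/

section CompleteHomogeneous

variable {ι : Type*} [DecidableEq ι]

/-- The complete homogeneous symmetric polynomial of degree `m` in the `x i`, `i ∈ s`. -/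
def completeHomogeneous (x : ι → ℂ) (s : Finset ι) (m : ℕ) : ℂ :=
  ∑ κ ∈ s.piAntidiag m, ∏ i ∈ s, x i ^ κ i

theorem completeHomogeneous_zero (x : ι → ℂ) (s : Finset ι) : completeHomogeneous x s 0 = 1 := by
  simp [completeHomogeneous]

theorem completeHomogeneous_cons (x : ι → ℂ) {s : Finset ι} {a : ι} (ha : a ∉ s) (n : ℕ) :
    completeHomogeneous x (Finset.cons a s ha) n =
      ∑ p ∈ Finset.HasAntidiagonal.antidiagonal n, x a ^ p.1 * completeHomogeneous x s p.2 := by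
  unfold completeHomogeneous
  rw [Finset.piAntidiag_cons, Finset.sum_disjiUnion]
  refine Finset.sum_congr rfl fun p _ => ?_
  rw [Finset.sum_map, Finset.mul_sum]
  refine Finset.sum_congr rfl fun κ hκ => ?_
  have hκa : κ a = 0 := by
    by_contra h
    exact ha ((Finset.mem_piAntidiag.1 hκ).2 a h)
  rw [Finset.prod_cons]
  congr 1
  · simp [hκa]
  · refine Finset.prod_congr rfl fun i hi => ?_
    have : i ≠ a := fun h => ha (h ▸ hi)
    simp [this]

/-- Monomials are separated by whether `x a` occurs. This is the recursion that the divided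
differences of powers satisfy. -/
theorem completeHomogeneous_cons_succ (x : ι → ℂ) {s : Finset ι} {a : ι} (ha : a ∉ s) (n : ℕ) :
    completeHomogeneous x (Finset.cons a s ha) (n + 1) =
      completeHomogeneous x s (n + 1) + x a * completeHomogeneous x (Finset.cons a s ha) n := by
  rw [completeHomogeneous_cons, completeHomogeneous_cons, Finset.Nat.sum_antidiagonal_succ,
    Finset.mul_sum]
  simp only [pow_zero, one_mul, pow_succ']
  congr 1
  exact Finset.sum_congr rfl fun p _ => by ring

theorem completeHomogeneous_singleton (x : ι → ℂ) (a : ι) (n : ℕ) :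
    completeHomogeneous x {a} n = x a ^ n := by
  have h1 : ({a} : Finset ι) = Finset.cons a ∅ (by simp) := by simp
  induction n with
  | zero => rw [completeHomogeneous_zero, pow_zero]
  | succ n ih =>
    rw [h1, completeHomogeneous_cons_succ, ← h1, ih, pow_succ']
    simp [completeHomogeneous]

/-- Divided differences of powers are complete homogeneous symmetric polynomials. -/
theorem dividedDifference_pow {r : ℝ} (hr : 0 ≤ r) (x : ι → ℂ) (s : Finset ι)
    (hx : ∀ i ∈ s, ‖x i‖ < r) (hs : s.Nonempty) (k : ℕ) :
    dividedDifference r (fun y => y ^ k) (s.val.map x) =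
      if k + 1 < s.card then 0 else completeHomogeneous x s (k + 1 - s.card) := by
  induction s using Finset.cons_induction generalizing k with
  | empty => exact absurd hs (by simp)
  | cons a s ha ih =>
    have har : ‖x a‖ < r := hx a (by simp)
    have hsr : ∀ i ∈ s, ‖x i‖ < r := fun i hi => hx i (by simp [hi])
    have hmr : ∀ z ∈ s.val.map x, ‖z‖ < r := by
      intro z hz
      obtain ⟨i, hi, rfl⟩ := Multiset.mem_map.1 hz
      exact hsr i hi
    rcases s.eq_empty_or_nonempty with rfl | hne
    · have h1 : (Finset.cons a ∅ ha : Finset ι) = {a} := by simp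
      rw [h1, completeHomogeneous_singleton]
      simp only [Finset.singleton_val, Multiset.map_singleton, Finset.card_singleton]
      rw [dividedDifference_singleton har (by fun_prop)]
      simp
    · have hc : 0 < s.card := hne.card_pos
      rw [Finset.card_cons]
      induction k with
      | zero =>
        rw [if_pos (by omega)]
        simp only [pow_zero]
        rw [Finset.cons_val, Multiset.map_cons]
        exact dividedDifference_one hr (by simpa using ⟨har, hsr⟩) (by simp; omega)
      | succ k ihk =>
        have key := dividedDifference_cons_affine_mul (f := fun y => y ^ k) hr har hmr
          (by fun_prop) 1 0
        simp only [one_mul, add_zero, ← pow_succ'] at key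
        rw [Finset.cons_val, Multiset.map_cons] at ihk ⊢
        rw [key, ihk, ih hsr hne k]
        -- Too few powers: all terms vanish. Equality: the constant `1` appears. Beyond: both sides
        -- obey the same recursion.
        rcases lt_trichotomy (k + 1) s.card with h | h | h
        · rw [if_pos (by omega), if_pos h, if_pos (by omega)]
          simp
        · rw [if_pos (by omega), if_neg (by omega), if_neg (by omega), h]
          simp [completeHomogeneous_zero]
        · obtain ⟨m, rfl⟩ : ∃ m, k = s.card + m := ⟨k - s.card, by omega⟩
          rw [if_neg (by omega), if_neg (by omega), if_neg (by omega),
            show s.card + m + 1 + 1 - (s.card + 1) = m + 1 by omega,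
            show s.card + m + 1 - (s.card + 1) = m by omega,
            show s.card + m + 1 - s.card = m + 1 by omega, completeHomogeneous_cons_succ]
          ring

end CompleteHomogeneous

/-! ### Closed forms of the power estimators -/

namespace Config

variable {Ω : Type*} {G : Subgroup (Equiv.Perm Ω)} {D : G → Ω → ℂ}

theorem energies_mem {r : ℝ} (hD : ∀ z, ‖D 1 z‖ < r) (c : Config G) (a b : ℕ) :
    ∀ x ∈ c.energies D a b, ‖x‖ < r := by
  intro x hx
  obtain ⟨i, _, rfl⟩ := Multiset.mem_map.1 hx
  exact hD _

theorem homogeneous_zero (c : Config G) (j : ℕ) : c.homogeneous D j 0 = 1 :=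
  completeHomogeneous_zero _ _

theorem homogeneous_q (c : Config G) (m : ℕ) : c.homogeneous D c.q m = c.energy D c.q ^ m := by
  have := completeHomogeneous_singleton (c.energy D) c.q m
  rwa [← Finset.Icc_self] at this

theorem homogeneous_succ (c : Config G) {j : ℕ} (hj : j + 1 ≤ c.q) (m : ℕ) :
    c.homogeneous D j (m + 1) =
      c.homogeneous D (j + 1) (m + 1) + c.energy D j * c.homogeneous D j m := by
  have h : Finset.Icc j c.q = Finset.cons j (Finset.Icc (j + 1) c.q) (by simp) := by
    ext i
    simp only [Finset.mem_Icc, Finset.mem_cons]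
    omega
  change completeHomogeneous _ _ _ = completeHomogeneous _ _ _ + _ * completeHomogeneous _ _ _
  rw [h, completeHomogeneous_cons_succ]

/-- The power `x ^ k` has zero divided difference on more than `k + 1` nodes, so only `j ≥ q - k`
survive; truncated subtraction in `c.q - k` provides the maximum with `0`. -/
theorem estFun_pow {r : ℝ} (hr : 0 ≤ r) (hD : ∀ z, ‖D 1 z‖ < r) (β : ℝ) (k : ℕ) :
    estFun β D r (fun x => x ^ k) = estPow β D k := by
  funext c
  unfold estFun estPow
  have hsub : Finset.Icc (c.q - k) c.q ⊆ Finset.range (c.q + 1) := by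
    intro j
    simp only [Finset.mem_Icc, Finset.mem_range]
    omega
  have hdd : ∀ j ∈ Finset.range (c.q + 1), dividedDifference r (fun x => x ^ k) (c.energies D j c.q) =
      if k < c.q - j then 0 else c.homogeneous D j (k - (c.q - j)) := by
    intro j hj
    rw [Finset.mem_range] at hj
    have := dividedDifference_pow hr (c.energy D) (Finset.Icc j c.q) (fun _ _ => hD _)
      (Finset.nonempty_Icc.2 (by omega)) k
    rw [Nat.card_Icc] at this
    unfold energies
    rw [this]
    by_cases h : k < c.q - j
    · rw [if_pos h, if_pos (by omega)]
    · rw [if_neg h, if_neg (by omega), show k + 1 - (c.q + 1 - j) = k - (c.q - j) by omega]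
      rfl
  rw [← Finset.sum_subset hsub]
  · refine Finset.sum_congr rfl fun j hj => ?_
    rw [hdd j (hsub hj), if_neg]
    simp only [Finset.mem_Icc] at hj
    omega
  · intro j hj hj'
    rw [hdd j hj, if_pos, zero_mul]
    simp only [Finset.mem_Icc, Finset.mem_range] at hj hj'
    omega

theorem ratio_q {β : ℝ} {c : Config G} (h : c.boltz β D 0 c.q ≠ 0) : c.ratio β D c.q = 1 :=
  div_self h

theorem estPow_one {β : ℝ} {c : Config G} (h : c.boltz β D 0 c.q ≠ 0) :
    estPow β D 1 c = estH β D c := by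
  unfold estPow estH
  have h1 := ratio_q h
  rcases hq : c.q with _ | q
  · rw [hq] at h1
    have := c.homogeneous_q (D := D) 1
    rw [hq] at this
    simp [h1, this]
  · have e0 := c.homogeneous_q (D := D) 1
    have e1 := c.homogeneous_zero (D := D) q
    rw [hq] at h1 e0
    rw [show q + 1 - 1 = q by omega, Finset.sum_Icc_succ_top (by omega)]
    simp [h1, e0, e1]
    ring

theorem estPow_two {β : ℝ} {c : Config G} (h : c.boltz β D 0 c.q ≠ 0) :
    estPow β D 2 c = estSq β D c := by
  unfold estPow estSq
  have h1 := ratio_q h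
  have e0 := c.homogeneous_q (D := D) 1
  have e0' := c.homogeneous_q (D := D) 2
  have e1 := fun j => c.homogeneous_zero (D := D) j
  have e2 := fun j hj => c.homogeneous_succ (D := D) (j := j) hj 0
  -- With the needed identities collected, only the order `q` matters; small orders have fewer terms
  -- and are treated separately.
  generalize c.q = q at *
  rcases q with _ | _ | q
  · simp [h1, e0']
  · have := e2 0 (by omega)
    simp only [zero_add] at this e0 e0' h1
    simp [Finset.sum_Icc_succ_top, h1, e0, e0', e1, this]
    ring
  · have := e2 (q + 1) (by omega)
    rw [show q + 1 + 1 - 2 = q by omega, Finset.sum_Icc_succ_top (by omega),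
      Finset.sum_Icc_succ_top (by omega), Finset.Icc_self, Finset.sum_singleton,
      show q + 1 + 1 - (q + 1) = 1 by omega, show q + 1 + 1 - q = 2 by omega]
    simp [h1, e0, e0', e1, this]
    ring

theorem estPow_three {β : ℝ} {c : Config G} (h : c.boltz β D 0 c.q ≠ 0) :
    estPow β D 3 c = estCube β D c := by
  unfold estPow estCube
  have h1 := ratio_q h
  have e0 := fun m => c.homogeneous_q (D := D) m
  have e1 := fun j => c.homogeneous_zero (D := D) j
  have e2 := fun j hj m => c.homogeneous_succ (D := D) (j := j) hj m
  generalize c.q = q at *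
  rcases q with _ | _ | _ | q
  · simp [h1, e0]
  · have := e2 0 (by omega) 1
    have := e2 0 (by omega) 0
    simp only [zero_add, Nat.reduceAdd] at *
    simp [Finset.sum_Icc_succ_top, *]
    ring
  · have a1 := e2 1 (by omega) 1
    have a2 := e2 1 (by omega) 0
    have a3 := e2 0 (by omega) 0
    simp only [zero_add, Nat.reduceAdd] at *
    simp [Finset.sum_Icc_succ_top, *]
    ring
  · have a1 := e2 (q + 1 + 1) (by omega) 1
    have a2 := e2 (q + 1 + 1) (by omega) 0
    have a3 := e2 (q + 1) (by omega) 0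
    rw [show q + 1 + 1 + 1 - 3 = q by omega, Finset.sum_Icc_succ_top (by omega),
      Finset.sum_Icc_succ_top (by omega), Finset.sum_Icc_succ_top (by omega), Finset.Icc_self,
      Finset.sum_singleton, show q + 1 + 1 + 1 - (q + 1 + 1) = 1 by omega,
      show q + 1 + 1 + 1 - (q + 1) = 2 by omega, show q + 1 + 1 + 1 - q = 3 by omega]
    simp only [zero_add, Nat.reduceAdd] at *
    simp [h1, e0, e1, a1, a2, a3, show q + 1 + 1 + 1 - 2 = q + 1 by omega]
    ring

end Config

end PMR

namespace PMR

open Metric Matrix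

/-! ### Weighted walks and their summability -/

section Walk

variable {Ω : Type*} {G : Subgroup (Equiv.Perm Ω)}

/-- The weight of the walk that starts in `z` and makes the successive steps `l`: the product of the
vertex weights `a` of all visited states and of the step weights `V`. -/
def walkWeight (a : Ω → ℂ) (V : G → Ω → ℂ) : List G → Ω → ℂ
  | [], z => a z
  | σ :: l, z => a z * V σ ((σ : Equiv.Perm Ω) z) * walkWeight a V l ((σ : Equiv.Perm Ω) z)

/-- The final state of the walk that starts in `z` and makes the successive steps `l`. -/
def walkEnd (l : List G) (z : Ω) : Ω := (l.reverse.prod : Equiv.Perm Ω) z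

theorem walkEnd_cons (σ : G) (l : List G) (z : Ω) :
    walkEnd (σ :: l) z = walkEnd l ((σ : Equiv.Perm Ω) z) := by simp [walkEnd]

/-- Allows one majorant of the vertex weights to dominate a walk uniformly in `x` on the circle. -/
theorem norm_walkWeight_le {a a' : Ω → ℂ} (h : ∀ z, ‖a z‖ ≤ ‖a' z‖) (V : G → Ω → ℂ) (l : List G)
    (z : Ω) : ‖walkWeight a V l z‖ ≤ ‖walkWeight a' V l z‖ := by
  induction l generalizing z with
  | nil => exact h z
  | cons σ l ih =>
    simp only [walkWeight, norm_mul]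
    have := ih ((σ : Equiv.Perm Ω) z)
    have := h z
    gcongr

/-- Let `ρ < 1` be the largest product of a vertex norm with the total norm of the steps leaving it.
Splitting off first steps bounds the total norm of the walks with `n` steps by a constant times `ρ ^
n`. -/
theorem summable_norm_walkWeight [Finite Ω] [Fintype G] {a : Ω → ℂ} {V : G → Ω → ℂ}
    (h : ∀ z, ‖a z‖ * ∑ σ : G, ‖V σ ((σ : Equiv.Perm Ω) z)‖ < 1) (z : Ω) :
    Summable fun l : List G => ‖walkWeight a V l z‖ := by
  have : Nonempty Ω := ⟨z⟩
  obtain ⟨z1, hz1⟩ := Finite.exists_max fun z => ‖a z‖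
  obtain ⟨z2, hz2⟩ := Finite.exists_max fun z => ‖a z‖ * ∑ σ : G, ‖V σ ((σ : Equiv.Perm Ω) z)‖
  set ρ := ‖a z2‖ * ∑ σ : G, ‖V σ ((σ : Equiv.Perm Ω) z2)‖ with hρ
  have hρ0 : 0 ≤ ρ := mul_nonneg (norm_nonneg _) (Finset.sum_nonneg fun _ _ => norm_nonneg _)
  have hS : ∀ (n : ℕ) (z : Ω), ∑ f : Fin n → G, ‖walkWeight a V (List.ofFn f) z‖ ≤
      ‖a z1‖ * ρ ^ n := by
    intro n
    induction n with
    | zero => intro z; simpa [walkWeight] using hz1 z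
    | succ n ih =>
      intro z
      rw [← (Fin.consEquiv fun _ => G).sum_comp, Fintype.sum_prod_type]
      simp only [Fin.consEquiv, Equiv.coe_fn_mk, List.ofFn_succ, Fin.cons_zero, Fin.cons_succ,
        walkWeight, norm_mul, ← Finset.mul_sum]
      calc ∑ σ : G, ‖a z‖ * ‖V σ ((σ : Equiv.Perm Ω) z)‖ *
              ∑ f : Fin n → G, ‖walkWeight a V (List.ofFn f) ((σ : Equiv.Perm Ω) z)‖
          ≤ ∑ σ : G, ‖a z‖ * ‖V σ ((σ : Equiv.Perm Ω) z)‖ * (‖a z1‖ * ρ ^ n) :=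
            Finset.sum_le_sum fun σ _ => mul_le_mul_of_nonneg_left (ih _) (by positivity)
        _ = (‖a z‖ * ∑ σ : G, ‖V σ ((σ : Equiv.Perm Ω) z)‖) * (‖a z1‖ * ρ ^ n) := by
            rw [← Finset.sum_mul, ← Finset.mul_sum]
        _ ≤ ρ * (‖a z1‖ * ρ ^ n) := mul_le_mul_of_nonneg_right (hz2 z) (by positivity)
        _ = ‖a z1‖ * ρ ^ (n + 1) := by ring
  -- Lists are grouped by length; each group is finite.
  rw [← List.equivSigmaTuple.symm.summable_iff]
  refine (summable_sigma_of_nonneg fun _ => norm_nonneg _).2 ⟨fun n => Summable.of_finite, ?_⟩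
  refine Summable.of_nonneg_of_le (fun n => tsum_nonneg fun _ => norm_nonneg _) (fun n => ?_)
    ((summable_geometric_of_lt_one hρ0 (h z2)).mul_left ‖a z1‖)
  rw [tsum_fintype]
  exact hS n z

open Classical in
/-- The total weight of the walks from `z` to `y`. -/
noncomputable def walkSum (a : Ω → ℂ) (V : G → Ω → ℂ) (y z : Ω) : ℂ :=
  ∑' l : List G, if walkEnd l z = y then walkWeight a V l z else 0

open Classical in
theorem summable_walkSum [Finite Ω] [Fintype G] {a : Ω → ℂ} {V : G → Ω → ℂ}
    (h : ∀ z, ‖a z‖ * ∑ σ : G, ‖V σ ((σ : Equiv.Perm Ω) z)‖ < 1) (y z : Ω) :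
    Summable fun l : List G => if walkEnd l z = y then walkWeight a V l z else 0 := by
  refine Summable.of_norm_bounded (summable_norm_walkWeight h z) fun l => ?_
  split_ifs <;> simp

open Classical in
/-- Splitting off the first step of a walk. -/
theorem walkSum_eq [Finite Ω] [Fintype G] {a : Ω → ℂ} {V : G → Ω → ℂ}
    (h : ∀ z, ‖a z‖ * ∑ σ : G, ‖V σ ((σ : Equiv.Perm Ω) z)‖ < 1) (y z : Ω) :
    walkSum a V y z = (if z = y then a z else 0) +
      ∑ σ : G, a z * V σ ((σ : Equiv.Perm Ω) z) * walkSum a V y ((σ : Equiv.Perm Ω) z) := by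
  have hs := summable_walkSum h y z
  unfold walkSum
  rw [hs.tsum_eq_add_tsum_ite []]
  congr 1
  -- The nonempty lists are parametrized by head and tail.
  · have hinj : Function.Injective fun p : G × List G => p.1 :: p.2 := by
      rintro ⟨σ, l⟩ ⟨τ, m⟩ hp
      simpa using hp
    have hs' : Summable fun l : List G =>
        if l = [] then 0 else if walkEnd l z = y then walkWeight a V l z else 0 := by
      refine Summable.of_norm_bounded (summable_norm_walkWeight h z) fun l => ?_
      split_ifs <;> simp
    rw [← hinj.tsum_eq]
    · refine (hs'.comp_injective hinj).tsum_prod.trans ?_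
      rw [tsum_fintype]
      refine Finset.sum_congr rfl fun σ _ => ?_
      rw [← tsum_mul_left]
      refine tsum_congr fun l => ?_
      simp [walkEnd_cons, walkWeight]
    · intro l hl
      rcases l with _ | ⟨σ, l⟩
      · simp at hl
      · exact ⟨(σ, l), rfl⟩

open Classical in
theorem hasSum_closed_walks [Fintype Ω] [Fintype G] {a : Ω → ℂ} {V : G → Ω → ℂ}
    (h : ∀ z, ‖a z‖ * ∑ σ : G, ‖V σ ((σ : Equiv.Perm Ω) z)‖ < 1) (w : Ω → ℂ) :
    HasSum (fun p : Ω × List G =>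
        if walkEnd p.2 p.1 = p.1 then w p.1 * walkWeight a V p.2 p.1 else 0)
      (∑ z, w z * walkSum a V z z) := by
  have hfib : ∀ z, HasSum (fun l : List G =>
      if walkEnd l z = z then w z * walkWeight a V l z else 0) (w z * walkSum a V z z) := by
    intro z
    simpa [mul_ite] using! (summable_walkSum h z z).hasSum.mul_left (w z)
  have hsum : Summable fun p : Ω × List G => ‖w p.1‖ * ‖walkWeight a V p.2 p.1‖ := by
    rw [summable_prod_of_nonneg fun _ => by positivity]
    refine ⟨fun z => ?_, ?_⟩
    · exact (summable_norm_walkWeight h z).mul_left ‖w z‖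
    · exact (hasSum_fintype _).summable
  have hs : Summable fun p : Ω × List G =>
      if walkEnd p.2 p.1 = p.1 then w p.1 * walkWeight a V p.2 p.1 else 0 := by
    refine Summable.of_norm_bounded hsum fun p => ?_
    split_ifs
    · rw [norm_mul]
    · simp only [norm_zero]; positivity
  have := hs.hasSum
  rwa [hs.tsum_prod, tsum_fintype, Finset.sum_congr rfl fun z _ => (hfib z).tsum_eq] at this

end Walk

/-- The step weights `D` without those of the identity. -/
noncomputable def offWeight {Ω : Type*} {G : Subgroup (Equiv.Perm Ω)} (D : G → Ω → ℂ) :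
    G → Ω → ℂ :=
  open Classical in fun σ z => if σ = 1 then 0 else D σ z

namespace Config

variable {Ω : Type*} {G : Subgroup (Equiv.Perm Ω)} {D : G → Ω → ℂ}

theorem pair_injective : Function.Injective fun c : Config G => (c.z, c.seq) := by
  rintro ⟨z, l, h1, h2⟩ ⟨z', l', h1', h2'⟩ h
  simp only [Prod.mk.injEq] at h
  obtain ⟨rfl, rfl⟩ := h
  rfl

instance [Finite Ω] : Countable (Config G) := pair_injective.countable

/-- Unrolls the recursive weight into the products over time that define `hopping`; there is one
more vertex factor than step factors. -/
theorem prod_walk (a : Ω → ℂ) (V : G → Ω → ℂ) (l : List G) (z : Ω) :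
    (∏ k : Fin l.length, V (l.get k) (((l.take (k + 1)).reverse.prod : Equiv.Perm Ω) z)) *
      ∏ i ∈ Finset.range (l.length + 1), a (((l.take i).reverse.prod : Equiv.Perm Ω) z) =
      walkWeight a V l z := by
  induction l generalizing z with
  | nil => simp [walkWeight]
  | cons σ l ih =>
    rw [walkWeight, ← ih]
    have h1 := Fin.prod_univ_succ (n := l.length) fun k => V ((σ :: l).get k)
      ((((σ :: l).take (k + 1)).reverse.prod : Equiv.Perm Ω) z)
    have h2 := Finset.prod_range_succ'
      (fun i => a ((((σ :: l).take i).reverse.prod : Equiv.Perm Ω) z)) (l.length + 1)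
    refine (congrArg₂ (· * ·) h1 h2).trans ?_
    simp
    ring

/-- For `a z = (x - D 1 z)⁻¹` the left side is the kernel of the contour integral of a
configuration. -/
theorem hopping_mul_prod (a : Ω → ℂ) (c : Config G) :
    c.hopping D * ∏ i ∈ Finset.Icc 0 c.q, a (c.state i) =
      walkWeight a (offWeight D) c.seq c.z := by
  rw [← prod_walk]
  congr 1
  · refine Finset.prod_congr rfl fun k _ => ?_
    rw [offWeight, if_neg (c.ne_one _ (List.get_mem _ _))]
    rfl
  · refine Finset.prod_congr ?_ fun i _ => rfl
    ext i
    simp only [Finset.mem_Icc, Finset.mem_range, q]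
    omega

theorem walkEnd_seq (c : Config G) : walkEnd c.seq c.z = c.z := by
  rw [walkEnd, c.closed]
  rfl

theorem state_q (c : Config G) : c.state c.q = c.z := by
  rw [state, q, List.take_length]
  exact c.walkEnd_seq

theorem walkWeight_offWeight_of_mem (a : Ω → ℂ) {l : List G} (h : (1 : G) ∈ l) (z : Ω) :
    walkWeight a (offWeight D) l z = 0 := by
  induction l generalizing z with
  | nil => simp at h
  | cons σ l ih =>
    rcases List.mem_cons.1 h with rfl | h
    · simp [walkWeight, offWeight]
    · simp [walkWeight, ih h]

/-- Configurations are the closed walks without identity steps. -/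
theorem hasSum_walkWeight [Fintype Ω] [Fintype G] (hG : HasRegularAction G) {a : Ω → ℂ}
    (h : ∀ z, ‖a z‖ * ∑ σ : G, ‖offWeight D σ ((σ : Equiv.Perm Ω) z)‖ < 1) (w : Ω → ℂ) :
    HasSum (fun c : Config G => w c.z * walkWeight a (offWeight D) c.seq c.z)
      (∑ z, w z * walkSum a (offWeight D) z z) := by
  classical
  have := hasSum_closed_walks h w
  rw [← pair_injective.hasSum_iff] at this
  · refine this.congr_fun ?_
    intro c
    simp [c.walkEnd_seq]
  · rintro ⟨z, l⟩ hzl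
    dsimp only
    split_ifs with hend
    · have h1 : (1 : G) ∈ l := by
        by_contra hl
        refine hzl ⟨⟨z, l, fun σ hσ h1 => hl (h1 ▸ hσ), ?_⟩, rfl⟩
        -- Freeness of the action: a product of steps that fixes the one state `z` is the identity.
        exact Subtype.ext (hG.2 _ (l.reverse.prod : G).2 z hend)
      rw [walkWeight_offWeight_of_mem a h1, mul_zero]
    · rfl

end Config

/-! ### Walk expansion of the resolvent -/

section Resolvent

variable {Ω : Type*} [Fintype Ω] [DecidableEq Ω] {G : Subgroup (Equiv.Perm Ω)} [Fintype G]
  {D : G → Ω → ℂ} {H : Matrix Ω Ω ℂ}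

/-- Freeness gives injectivity and transitivity surjectivity, so `G` indexes each column of `H`. -/
theorem IsPMRForm.bijective (h : IsPMRForm G D H) (z : Ω) :
    Function.Bijective fun σ : G => (σ : Equiv.Perm Ω) z := by
  constructor
  · intro σ τ hst
    have : (τ⁻¹ * σ : G) = 1 := by
      refine Subtype.ext (h.1.2 _ (τ⁻¹ * σ : G).2 z ?_)
      simp only [Subgroup.coe_mul, Subgroup.coe_inv, Equiv.Perm.coe_mul, Function.comp_apply]
      rw [Equiv.Perm.inv_eq_iff_eq]
      exact hst
    exact (inv_mul_eq_one.1 this).symm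
  · intro y
    obtain ⟨σ, hσ, hy⟩ := h.1.1 z y
    exact ⟨⟨σ, hσ⟩, hy⟩

theorem IsPMRForm.apply (h : IsPMRForm G D H) (σ : G) (z : Ω) :
    H ((σ : Equiv.Perm Ω) z) z = D σ ((σ : Equiv.Perm Ω) z) := by
  rw [h.2, Matrix.sum_apply, Finset.sum_eq_single σ]
  · simp [permMat, Matrix.diagonal_mul]
  · intro τ _ hτ
    have : (τ : Equiv.Perm Ω) z ≠ (σ : Equiv.Perm Ω) z := fun he => hτ ((h.bijective z).1 he)
    simp [permMat, Matrix.diagonal_mul, this]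
  · simp

theorem IsPMRForm.apply_self (h : IsPMRForm G D H) (z : Ω) : H z z = D 1 z := h.apply 1 z

theorem IsPMRForm.sum_col {M : Type*} [AddCommMonoid M] (h : IsPMRForm G D H) (z : Ω)
    (f : Ω → M) : ∑ y, f y = ∑ σ : G, f ((σ : Equiv.Perm Ω) z) :=
  ((Equiv.ofBijective _ (h.bijective z)).sum_comp f).symm

theorem sum_eq_add_offWeight {M : Type*} [AddCommMonoid M] (F : G → Ω → ℂ → M)
    (hF : ∀ σ z, F σ z 0 = 0) (z : Ω) :
    ∑ σ : G, F σ z (D σ ((σ : Equiv.Perm Ω) z)) =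
      F 1 z (D 1 z) + ∑ σ : G, F σ z (offWeight D σ ((σ : Equiv.Perm Ω) z)) := by
  classical
  rw [← Finset.add_sum_erase _ _ (Finset.mem_univ (1 : G)),
    ← Finset.add_sum_erase _ (fun σ : G => F σ z (offWeight D σ ((σ : Equiv.Perm Ω) z)))
      (Finset.mem_univ (1 : G))]
  have h1 : offWeight D 1 (((1 : G) : Equiv.Perm Ω) z) = 0 := by simp [offWeight]
  rw [h1, hF, zero_add]
  congr 1
  refine Finset.sum_congr rfl fun σ hσ => ?_
  rw [offWeight, if_neg (Finset.ne_of_mem_erase hσ)]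

/-- The left side is a column sum of `|H|`; hermiticity equates it with the row sum that is bounded.
-/
theorem IsPMRForm.norm_add_sum_lt (h : IsPMRForm G D H) (hH : H.IsHermitian) {r : ℝ}
    (hr : ∀ x, ∑ y, ‖H x y‖ < r) (z : Ω) :
    ‖D 1 z‖ + ∑ σ : G, ‖offWeight D σ ((σ : Equiv.Perm Ω) z)‖ < r := by
  rw [← sum_eq_add_offWeight (fun _ _ x => ‖x‖) (by simp)]
  refine lt_of_eq_of_lt ?_ (hr z)
  simp only [← h.apply]
  rw [← h.sum_col z fun y => ‖H y z‖]
  exact Finset.sum_congr rfl fun y _ => by rw [← hH.apply y z, norm_star]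

theorem IsPMRForm.norm_diag_lt (h : IsPMRForm G D H) (hH : H.IsHermitian) {r : ℝ}
    (hr : ∀ x, ∑ y, ‖H x y‖ < r) (z : Ω) : ‖D 1 z‖ < r :=
  lt_of_le_of_lt (le_add_of_nonneg_right (Finset.sum_nonneg fun _ _ => norm_nonneg _))
    (h.norm_add_sum_lt hH hr z)

/-- Diagonal dominance: the off-diagonal column sum is less than `r - ‖D 1 z‖`. This is the
hypothesis under which walks are summable. -/
theorem IsPMRForm.step_lt_one (h : IsPMRForm G D H) (hH : H.IsHermitian) {r : ℝ}
    (hr : ∀ x, ∑ y, ‖H x y‖ < r) {a : Ω → ℂ} (ha : ∀ z, ‖a z‖ ≤ (r - ‖D 1 z‖)⁻¹) (z : Ω) :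
    ‖a z‖ * ∑ σ : G, ‖offWeight D σ ((σ : Equiv.Perm Ω) z)‖ < 1 := by
  have h1 := h.norm_add_sum_lt hH hr z
  have h2 : 0 < r - ‖D 1 z‖ := sub_pos.2 (h.norm_diag_lt hH hr z)
  refine (mul_le_mul_of_nonneg_right (ha z) (Finset.sum_nonneg fun _ _ => norm_nonneg _)).trans_lt ?_
  rw [inv_mul_lt_one₀ h2]
  linarith

theorem IsPMRForm.norm_inv_sub_le (h : IsPMRForm G D H) (hH : H.IsHermitian) {r : ℝ}
    (hr : ∀ x, ∑ y, ‖H x y‖ < r) {x : ℂ} (hx : r ≤ ‖x‖) (z : Ω) :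
    ‖(x - D 1 z)⁻¹‖ ≤ (r - ‖D 1 z‖)⁻¹ := by
  have h2 : 0 < r - ‖D 1 z‖ := sub_pos.2 (h.norm_diag_lt hH hr z)
  rw [norm_inv]
  have := norm_sub_norm_le x (D 1 z)
  gcongr
  linarith

/-- The walk expansion of the resolvent. -/
theorem IsPMRForm.walkSum_mul (h : IsPMRForm G D H) (hH : H.IsHermitian) {r : ℝ}
    (hr : ∀ x, ∑ y, ‖H x y‖ < r) {x : ℂ} (hx : r ≤ ‖x‖) :
    Matrix.of (walkSum (fun z => (x - D 1 z)⁻¹) (offWeight D)) * (x • (1 : Matrix Ω Ω ℂ) - H) = 1 := by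
  set T := walkSum (fun z => (x - D 1 z)⁻¹) (offWeight D) with hT
  ext y z
  -- The first-step recursion, multiplied by `x - D 1 z`, is the `(y, z)` entry of the claim.
  have hstep := walkSum_eq (h.step_lt_one hH hr (h.norm_inv_sub_le hH hr hx)) y z
  rw [← hT] at hstep
  have hne : x - D 1 z ≠ 0 := by
    intro h0
    have := h.norm_diag_lt hH hr z
    rw [← sub_eq_zero.1 h0] at this
    linarith
  have hmul : (Matrix.of T * H) y z = T y z * D 1 z +
      ∑ σ : G, T y ((σ : Equiv.Perm Ω) z) * offWeight D σ ((σ : Equiv.Perm Ω) z) := by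
    rw [Matrix.mul_apply, h.sum_col z]
    simp only [h.apply, Matrix.of_apply]
    exact sum_eq_add_offWeight (fun σ z v => T y ((σ : Equiv.Perm Ω) z) * v) (by simp) z
  rw [Matrix.mul_sub, Matrix.sub_apply, hmul, Matrix.mul_smul, Matrix.mul_one, Matrix.smul_apply,
    Matrix.of_apply, smul_eq_mul, Matrix.one_apply]
  simp only [mul_assoc, ← Finset.mul_sum] at hstep
  have hsum : ∑ σ : G, T y ((σ : Equiv.Perm Ω) z) * offWeight D σ ((σ : Equiv.Perm Ω) z) =
      ∑ σ : G, offWeight D σ ((σ : Equiv.Perm Ω) z) * T y ((σ : Equiv.Perm Ω) z) :=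
    Finset.sum_congr rfl fun _ _ => mul_comm _ _
  rw [hsum]
  have : (x - D 1 z) * T y z = (if y = z then 1 else 0) +
      ∑ σ : G, offWeight D σ ((σ : Equiv.Perm Ω) z) * T y ((σ : Equiv.Perm Ω) z) := by
    rw [hstep, mul_add, mul_inv_cancel_left₀ hne]
    congr 1
    by_cases hyz : y = z
    · simp [hyz, hne]
    · simp [hyz, Ne.symm hyz]
  linear_combination this

end Resolvent

end PMR

namespace PMR

open Metric Matrix

theorem exists_row_sum_lt {Ω : Type*} [Fintype Ω] (H : Matrix Ω Ω ℂ) : ∃ r : ℝ, ∀ x, ∑ y, ‖H x y‖ < r := by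
  refine ⟨1 + ∑ x, ∑ y, ‖H x y‖, fun x => ?_⟩
  have : ∑ y, ‖H x y‖ ≤ ∑ x, ∑ y, ‖H x y‖ := Finset.single_le_sum
    (f := fun x => ∑ y, ‖H x y‖) (fun x _ => Finset.sum_nonneg fun _ _ => norm_nonneg _)
    (Finset.mem_univ x)
  linarith

/-! ### Diagonalization, trace expansion and estimators -/

section Spectral

variable {Ω : Type*} [Fintype Ω] [DecidableEq Ω] {H : Matrix Ω Ω ℂ} (hH : H.IsHermitian)

/-- The function `f` of the Hermitian matrix `H`, by diagonalization. -/
noncomputable def spectralFun (f : ℂ → ℂ) : Matrix Ω Ω ℂ :=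
  (hH.eigenvectorUnitary : Matrix Ω Ω ℂ) * diagonal (fun i => f (hH.eigenvalues i)) *
    star (hH.eigenvectorUnitary : Matrix Ω Ω ℂ)

theorem star_eigenvectorUnitary_mul :
    star (hH.eigenvectorUnitary : Matrix Ω Ω ℂ) * (hH.eigenvectorUnitary : Matrix Ω Ω ℂ) = 1 :=
  Unitary.coe_star_mul_self _

theorem eigenvectorUnitary_mul_star :
    (hH.eigenvectorUnitary : Matrix Ω Ω ℂ) * star (hH.eigenvectorUnitary : Matrix Ω Ω ℂ) = 1 :=
  Unitary.coe_mul_star_self _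

theorem spectralFun_mul (f g : ℂ → ℂ) :
    spectralFun hH f * spectralFun hH g = spectralFun hH fun x => f x * g x := by
  unfold spectralFun
  rw [← diagonal_mul_diagonal]
  simp only [Matrix.mul_assoc]
  rw [← Matrix.mul_assoc (star _) (hH.eigenvectorUnitary : Matrix Ω Ω ℂ),
    star_eigenvectorUnitary_mul, Matrix.one_mul]

theorem spectralFun_id : spectralFun hH (fun x => x) = H := by
  conv_rhs => rw [hH.spectral_theorem]
  rfl

theorem spectralFun_const (c : ℂ) : spectralFun hH (fun _ => c) = c • (1 : Matrix Ω Ω ℂ) := by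
  unfold spectralFun
  rw [← smul_one_eq_diagonal, Matrix.mul_smul, Matrix.mul_one, Matrix.smul_mul,
    eigenvectorUnitary_mul_star]

theorem spectralFun_sub (f g : ℂ → ℂ) :
    spectralFun hH (fun x => f x - g x) = spectralFun hH f - spectralFun hH g := by
  unfold spectralFun
  rw [← diagonal_sub, Matrix.mul_sub, Matrix.sub_mul]

theorem spectralFun_pow (n : ℕ) : spectralFun hH (fun x => x ^ n) = H ^ n := by
  induction n with
  | zero => simp [spectralFun_const]
  | succ n ih =>
    have := spectralFun_mul hH (fun x => x ^ n) fun x => x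
    rw [spectralFun_id, ih] at this
    rw [pow_succ, this]
    simp only [pow_succ]

theorem commute_spectralFun (f : ℂ → ℂ) : H * spectralFun hH f = spectralFun hH f * H := by
  have h1 := spectralFun_mul hH (fun x => x) f
  have h2 := spectralFun_mul hH f (fun x => x)
  rw [spectralFun_id] at h1 h2
  rw [h1, h2]
  simp only [mul_comm]

theorem trace_spectralFun (f : ℂ → ℂ) :
    (spectralFun hH f).trace = ∑ i, f (hH.eigenvalues i) := by
  unfold spectralFun
  rw [Matrix.trace_mul_cycle, star_eigenvectorUnitary_mul, Matrix.one_mul, trace_diagonal]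

/-- The coefficients `p` do not depend on `f`, so the same ones serve for the resolvent under the
integral and for the final function. -/
theorem exists_trace_diagonal_mul_spectralFun (w : Ω → ℂ) :
    ∃ p : Ω → ℂ, ∀ f : ℂ → ℂ,
      (diagonal w * spectralFun hH f).trace = ∑ i, p i * f (hH.eigenvalues i) := by
  refine ⟨fun i => (star (hH.eigenvectorUnitary : Matrix Ω Ω ℂ) *
    (diagonal w * (hH.eigenvectorUnitary : Matrix Ω Ω ℂ))) i i, fun f => ?_⟩
  unfold spectralFun
  rw [← Matrix.mul_assoc, ← Matrix.mul_assoc, Matrix.trace_mul_comm, ← Matrix.mul_assoc]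
  simp [Matrix.trace, Matrix.mul_diagonal]

/-- A convergent power series on the spectrum. -/
theorem hasSum_spectralFun {g : ℂ → ℂ} {c : ℕ → ℂ}
    (h : ∀ i, HasSum (fun n => c n * (hH.eigenvalues i : ℂ) ^ n) (g (hH.eigenvalues i))) :
    HasSum (fun n => c n • H ^ n) (spectralFun hH g) := by
  have h1 : HasSum (fun n => fun i => c n * (hH.eigenvalues i : ℂ) ^ n)
      (fun i => g (hH.eigenvalues i)) := Pi.hasSum.2 h
  have h2 := (h1.matrix_diagonal.mul_left (hH.eigenvectorUnitary : Matrix Ω Ω ℂ)).mul_right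
    (star (hH.eigenvectorUnitary : Matrix Ω Ω ℂ))
  refine h2.congr_fun fun n => ?_
  change c n • H ^ n = spectralFun hH fun x => c n * x ^ n
  rw [← spectralFun_mul, spectralFun_const, spectralFun_pow, Matrix.smul_mul, Matrix.one_mul]

theorem gibbs_eq_spectralFun (β : ℝ) :
    gibbs β H = spectralFun hH fun x => Complex.exp (((-β : ℝ) : ℂ) * x) := by
  have : HasSum (fun n : ℕ => (((n.factorial : ℂ))⁻¹ * ((-β : ℝ) : ℂ) ^ n) • H ^ n)
      (spectralFun hH fun x => Complex.exp (((-β : ℝ) : ℂ) * x)) := by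
    refine hasSum_spectralFun hH fun i => ?_
    have := NormedSpace.exp_series_hasSum_exp' (𝕂 := ℂ) (((-β : ℝ) : ℂ) * (hH.eigenvalues i : ℂ))
    rw [← Complex.exp_eq_exp_ℂ] at this
    simpa only [mul_pow, mul_assoc, smul_eq_mul] using this
  rw [← this.tsum_eq, gibbs, NormedSpace.exp_eq_tsum ℂ]
  refine tsum_congr fun n => ?_
  rw [smul_pow, smul_smul]
  push_cast
  rfl

include hH in
theorem gibbs_trace_ne_zero [Nonempty Ω] (β : ℝ) : (gibbs β H).trace ≠ 0 := by
  rw [gibbs_eq_spectralFun hH, trace_spectralFun]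
  have : (∑ i, Complex.exp (((-β : ℝ) : ℂ) * (hH.eigenvalues i : ℂ))) =
      ((∑ i, Real.exp (-β * hH.eigenvalues i) : ℝ) : ℂ) := by push_cast; rfl
  rw [this, Complex.ofReal_ne_zero]
  exact (Finset.sum_pos (fun i _ => Real.exp_pos _) Finset.univ_nonempty).ne'

variable {G : Subgroup (Equiv.Perm Ω)} [Fintype G] {D : G → Ω → ℂ}

include hH

/-- The walk sum is a left inverse of `x - H`; conjugated into the eigenbasis it is a left inverse
of a diagonal matrix, which then has no zero entry. Hence the spectrum lies in the open disc. -/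
theorem IsPMRForm.sub_eigenvalue_ne_zero (h : IsPMRForm G D H) {r : ℝ}
    (hr : ∀ x, ∑ y, ‖H x y‖ < r) {x : ℂ} (hx : r ≤ ‖x‖) (i : Ω) :
    x - hH.eigenvalues i ≠ 0 := by
  have hT := h.walkSum_mul hH hr hx
  set T := Matrix.of (walkSum (fun z => (x - D 1 z)⁻¹) (offWeight D))
  have hx' : x • (1 : Matrix Ω Ω ℂ) - H = spectralFun hH fun y => x - y := by
    rw [spectralFun_sub, spectralFun_const, spectralFun_id]
  have hD : (star (hH.eigenvectorUnitary : Matrix Ω Ω ℂ) * T * hH.eigenvectorUnitary) *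
      diagonal (fun i => x - (hH.eigenvalues i : ℂ)) = 1 := by
    rw [hx', spectralFun] at hT
    calc _ = star (hH.eigenvectorUnitary : Matrix Ω Ω ℂ) * (T * (hH.eigenvectorUnitary *
          diagonal (fun i => x - (hH.eigenvalues i : ℂ)) *
            star (hH.eigenvectorUnitary : Matrix Ω Ω ℂ))) * hH.eigenvectorUnitary := by
          simp only [Matrix.mul_assoc, star_eigenvectorUnitary_mul, Matrix.mul_one]
      _ = 1 := by rw [hT, Matrix.mul_one, star_eigenvectorUnitary_mul]
  intro h0
  have := congrFun (congrFun hD i) i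
  rw [Matrix.mul_diagonal, h0, mul_zero, Matrix.one_apply_eq] at this
  exact zero_ne_one this

theorem IsPMRForm.norm_eigenvalue_lt (h : IsPMRForm G D H) {r : ℝ}
    (hr : ∀ x, ∑ y, ‖H x y‖ < r) (i : Ω) : ‖(hH.eigenvalues i : ℂ)‖ < r := by
  by_contra hlt
  exact h.sub_eigenvalue_ne_zero hH hr (not_lt.1 hlt) i (sub_self _)

theorem IsPMRForm.walkSum_eq_spectralFun (h : IsPMRForm G D H) {r : ℝ}
    (hr : ∀ x, ∑ y, ‖H x y‖ < r) {x : ℂ} (hx : r ≤ ‖x‖) :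
    Matrix.of (walkSum (fun z => (x - D 1 z)⁻¹) (offWeight D)) =
      spectralFun hH fun y => (x - y)⁻¹ := by
  refine left_inv_eq_right_inv (h.walkSum_mul hH hr hx) ?_
  rw [show x • (1 : Matrix Ω Ω ℂ) - H = spectralFun hH fun y => x - y by
    rw [spectralFun_sub, spectralFun_const, spectralFun_id], spectralFun_mul]
  have : ∀ i, (x - (hH.eigenvalues i : ℂ)) * (x - (hH.eigenvalues i : ℂ))⁻¹ = 1 := fun i =>
    mul_inv_cancel₀ (h.sub_eigenvalue_ne_zero hH hr hx i)
  unfold spectralFun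
  simp only [this, diagonal_one, Matrix.mul_one, eigenvectorUnitary_mul_star]

/-- The off-diagonal series expansion of the (weighted) trace of a function of `H`. -/
theorem IsPMRForm.hasSum_hopping_mul_dividedDifference [Nonempty Ω] (h : IsPMRForm G D H) {r : ℝ}
    (hr : ∀ x, ∑ y, ‖H x y‖ < r) {f : ℂ → ℂ} (hf : DifferentiableOn ℂ f (closedBall 0 r))
    (w : Ω → ℂ) :
    HasSum (fun c : Config G =>
        w c.z * (c.hopping D * dividedDifference r f (c.energies D 0 c.q)))
      (diagonal w * spectralFun hH f).trace := by
  have hr0 : 0 < r := (Finset.sum_nonneg fun _ _ => norm_nonneg _).trans_lt (hr (Classical.arbitrary Ω))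
  have hDr := h.norm_diag_lt hH hr
  obtain ⟨p, hp⟩ := exists_trace_diagonal_mul_spectralFun hH w
  have hfc : ContinuousOn f (sphere 0 r) := hf.continuousOn.mono sphere_subset_closedBall
  obtain ⟨M, hM⟩ := (isCompact_sphere (0 : ℂ) r).exists_bound_of_continuousOn hfc
  have hprod : ∀ (c : Config G) (x : ℂ), c.hopping D / ((c.energies D 0 c.q).map fun e => x - e).prod
      = walkWeight (fun z => (x - D 1 z)⁻¹) (offWeight D) c.seq c.z := by
    intro c x
    rw [← Config.hopping_mul_prod, Finset.prod_inv_distrib, div_eq_mul_inv, Config.energies,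
      Multiset.map_map]
    rfl
  -- The majorant replaces every vertex factor by its largest possible size on the circle.
  set b : Config G → ℝ := fun c => M * (‖w c.z‖ *
    ‖walkWeight (fun z => (((r - ‖D 1 z‖)⁻¹ : ℝ) : ℂ)) (offWeight D) c.seq c.z‖) with hb
  have ha' : ∀ z, ‖(((r - ‖D 1 z‖)⁻¹ : ℝ) : ℂ)‖ = (r - ‖D 1 z‖)⁻¹ := fun z => by
    rw [Complex.norm_real, Real.norm_of_nonneg (inv_nonneg.2 (sub_pos.2 (hDr z)).le)]
  have hbs : Summable b := by
    refine Summable.mul_left M ?_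
    simp only [← norm_mul]
    exact (Config.hasSum_walkWeight h.1 (h.step_lt_one hH hr fun z => (ha' z).le) w).summable.norm
  have key : HasSum (fun c : Config G => ∮ x in C(0, r), f x *
      (w c.z * (c.hopping D / ((c.energies D 0 c.q).map fun e => x - e).prod)))
      (∮ x in C(0, r), f x * ∑ i, p i * (x - hH.eigenvalues i)⁻¹) := by
    refine hasSum_circleIntegral_of_dominated hr0.le (b := b) ?_ ?_ hbs ?_
    · intro c
      exact hfc.mul (continuousOn_const.mul (continuousOn_div_prod_sub
        (c.energies_mem hDr 0 c.q) continuousOn_const))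
    · intro c x hx
      rw [hprod, norm_mul, norm_mul]
      have h1 := hM x hx
      have h2 := norm_walkWeight_le (a := fun z => (x - D 1 z)⁻¹)
        (a' := fun z => (((r - ‖D 1 z‖)⁻¹ : ℝ) : ℂ)) (fun z => by
          rw [ha']
          exact h.norm_inv_sub_le hH hr (mem_sphere_zero_iff_norm.1 hx).ge z) (offWeight D) c.seq c.z
      have h3 : 0 ≤ M := (norm_nonneg _).trans h1
      simp only [hb]
      gcongr
    · intro x hx
      have hx' : r ≤ ‖x‖ := (mem_sphere_zero_iff_norm.1 hx).ge
      simp only [hprod]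
      refine HasSum.mul_left _ ?_
      have htr : ∑ z, w z * walkSum (fun z => (x - D 1 z)⁻¹) (offWeight D) z z =
          ∑ i, p i * (x - hH.eigenvalues i)⁻¹ := by
        rw [← hp fun y => (x - y)⁻¹, ← h.walkSum_eq_spectralFun hH hr hx']
        simp [Matrix.trace, Matrix.diagonal_mul]
      rw [← htr]
      exact Config.hasSum_walkWeight h.1
        (h.step_lt_one hH hr (h.norm_inv_sub_le hH hr hx')) w
  have hfin := key.mul_left (2 * Real.pi * Complex.I)⁻¹
  -- Cauchy's formula at each eigenvalue.
  have hval : (diagonal w * spectralFun hH f).trace = (2 * Real.pi * Complex.I)⁻¹ *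
      ∮ x in C(0, r), f x * ∑ i, p i * (x - hH.eigenvalues i)⁻¹ := by
    rw [hp]
    have h1 : ∀ x : ℂ, f x * ∑ i, p i * (x - hH.eigenvalues i)⁻¹ =
        ∑ i, p i * (f x / (x - hH.eigenvalues i)) := by
      intro x
      rw [Finset.mul_sum]
      exact Finset.sum_congr rfl fun i _ => by ring
    simp only [h1]
    rw [circleIntegral.integral_fun_sum, Finset.mul_sum]
    · refine Finset.sum_congr rfl fun i _ => ?_
      rw [← dividedDifference_singleton (h.norm_eigenvalue_lt hH hr i) hf,
        circleIntegral.integral_const_mul]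
      simp only [dividedDifference, Multiset.map_singleton, Multiset.prod_singleton]
      ring
    · intro i _
      refine ContinuousOn.circleIntegrable hr0.le (continuousOn_const.mul (hfc.div (by fun_prop) ?_))
      intro x hx
      exact sub_ne_zero_of_mem_sphere hx (h.norm_eigenvalue_lt hH hr i)
  rw [hval]
  refine hfin.congr_fun fun c => ?_
  unfold dividedDifference
  have : ∀ x : ℂ, f x * (w c.z * (c.hopping D / ((c.energies D 0 c.q).map fun e => x - e).prod)) =
      (w c.z * c.hopping D) * (f x / ((c.energies D 0 c.q).map fun e => x - e).prod) := by
    intro x; ring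
  simp only [this, circleIntegral.integral_const_mul]
  ring

theorem IsPMRForm.boltz_eq [Nonempty Ω] (h : IsPMRForm G D H) {r : ℝ}
    (hr : ∀ x, ∑ y, ‖H x y‖ < r) (β : ℝ) (c : Config G) (a b : ℕ) :
    c.boltz β D a b =
      dividedDifference r (fun x => Complex.exp (((-β : ℝ) : ℂ) * x)) (c.energies D a b) :=
  dde_eq_dividedDifference ((norm_nonneg _).trans_lt (h.norm_diag_lt hH hr (Classical.arbitrary Ω)))
    (c.energies_mem (h.norm_diag_lt hH hr) a b) _

theorem IsPMRForm.boltz_ne_zero [Nonempty Ω] (h : IsPMRForm G D H) {β : ℝ} (hβ : 0 < β)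
    (c : Config G) : c.boltz β D 0 c.q ≠ 0 := by
  obtain ⟨r, hr⟩ := exists_row_sum_lt H
  rw [h.boltz_eq hH hr]
  refine dividedDifference_exp_ne_zero hβ (c.energies_mem (h.norm_diag_lt hH hr) _ _) ?_ ?_
  · intro x hx
    obtain ⟨i, _, rfl⟩ := Multiset.mem_map.1 hx
    refine ⟨(H (c.state i) (c.state i)).re, ?_⟩
    rw [Config.energy, ← h.apply_self]
    exact (hH.coe_re_apply_self _).symm
  · rw [Config.energies, Ne, Multiset.map_eq_zero, Finset.val_eq_zero]
    exact (Finset.nonempty_Icc.2 (Nat.zero_le _)).ne_empty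

/-- In the common eigenbasis `g(H) e^{-βH}` is the function `g(x) e^{-βx}` of `H`; the Leibniz rule
splits its divided difference. -/
theorem IsPMRForm.hasSum_hopping [Nonempty Ω] (h : IsPMRForm G D H) {r : ℝ}
    (hr : ∀ x, ∑ y, ‖H x y‖ < r) (β : ℝ) {g : ℂ → ℂ}
    (hg : DifferentiableOn ℂ g (closedBall 0 r)) (w : Ω → ℂ) :
    HasSum (fun c : Config G => w c.z * (c.hopping D * ∑ j ∈ Finset.range (c.q + 1),
        dividedDifference r g (c.energies D j c.q) * c.boltz β D 0 j))
      (diagonal w * (spectralFun hH g * gibbs β H)).trace := by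
  have hr0 : 0 < r := (norm_nonneg _).trans_lt (h.norm_diag_lt hH hr (Classical.arbitrary Ω))
  have he : Differentiable ℂ fun x : ℂ => Complex.exp (((-β : ℝ) : ℂ) * x) := by fun_prop
  rw [gibbs_eq_spectralFun hH, spectralFun_mul]
  refine (h.hasSum_hopping_mul_dividedDifference hH hr
    (hg.mul he.differentiableOn) w).congr_fun fun c => ?_
  have := dividedDifference_mul hr0.le hg he c.q (c.energy D) fun i => h.norm_diag_lt hH hr _
  simp only [h.boltz_eq hH hr]
  exact congrArg (fun t => w c.z * (c.hopping D * t)) this.symm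

theorem IsPMRForm.hasSum_estFun [Nonempty Ω] (h : IsPMRForm G D H) {r : ℝ}
    (hr : ∀ x, ∑ y, ‖H x y‖ < r) {β : ℝ} (hβ : 0 < β) {g : ℂ → ℂ}
    (hg : DifferentiableOn ℂ g (closedBall 0 r)) (w : Ω → ℂ) :
    HasSum (fun c : Config G => w c.z * (c.weight β D * c.estFun β D r g))
      (diagonal w * (spectralFun hH g * gibbs β H)).trace := by
  refine (h.hasSum_hopping hH hr β hg w).congr_fun fun c => ?_
  have hb := h.boltz_ne_zero hH hβ c
  rw [Config.weight, Config.estFun, mul_assoc, Finset.mul_sum]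
  congr 2
  refine Finset.sum_congr rfl fun j _ => ?_
  rw [Config.ratio]
  field_simp

theorem IsPMRForm.hasSum_estPow [Nonempty Ω] (h : IsPMRForm G D H) {β : ℝ} (hβ : 0 < β) (k : ℕ)
    (w : Ω → ℂ) :
    HasSum (fun c : Config G => w c.z * (c.weight β D * c.estPow β D k))
      (diagonal w * (H ^ k * gibbs β H)).trace := by
  obtain ⟨r, hr⟩ := exists_row_sum_lt H
  have hr0 : 0 < r := (norm_nonneg _).trans_lt (h.norm_diag_lt hH hr (Classical.arbitrary Ω))
  have := h.hasSum_estFun hH hr hβ (g := fun x => x ^ k) (by fun_prop) w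
  rwa [spectralFun_pow, Config.estFun_pow hr0.le (h.norm_diag_lt hH hr)] at this

/-- Makes the case `k = 0` of the power expansion the expansion of the partition function. -/
theorem IsPMRForm.estPow_zero [Nonempty Ω] (h : IsPMRForm G D H) {β : ℝ} (hβ : 0 < β)
    (c : Config G) : c.estPow β D 0 = 1 := by
  simp [Config.estPow, Config.homogeneous_zero, Config.ratio_q (h.boltz_ne_zero hH hβ c)]

theorem IsPMRForm.hasSum_weight [Nonempty Ω] (h : IsPMRForm G D H) {β : ℝ} (hβ : 0 < β) :
    HasSum (fun c : Config G => c.weight β D) (gibbs β H).trace := by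
  simpa [h.estPow_zero hH hβ] using h.hasSum_estPow hH hβ 0 fun _ => 1

theorem IsPMRForm.isEstimator [Nonempty Ω] (h : IsPMRForm G D H) {β : ℝ} (hβ : 0 < β)
    {A : Matrix Ω Ω ℂ} {est : Config G → ℂ}
    (hs : HasSum (fun c : Config G => c.weight β D * est c) (A * gibbs β H).trace) :
    IsEstimator β D H A est := by
  have hw := h.hasSum_weight hH hβ
  refine ⟨hw.summable, hs.summable, ?_, ?_⟩
  · rw [hw.tsum_eq]
    exact gibbs_trace_ne_zero hH β
  · rw [hw.tsum_eq, hs.tsum_eq, thermal]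

theorem IsPMRForm.isEstimator_pow [Nonempty Ω] (h : IsPMRForm G D H) {β : ℝ} (hβ : 0 < β) (k : ℕ) :
    IsEstimator β D H (H ^ k) (Config.estPow β D k) :=
  h.isEstimator hH hβ (by simpa using h.hasSum_estPow hH hβ k fun _ => 1)

theorem IsPMRForm.hasSum_taylorTerm (h : IsPMRForm G D H) {r : ℝ} (hr : ∀ x, ∑ y, ‖H x y‖ < r) {g : ℂ → ℂ}
    (hg : DifferentiableOn ℂ g (closedBall 0 r)) :
    HasSum (taylorTerm g H) (spectralFun hH g) := by
  refine hasSum_spectralFun hH fun i => ?_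
  have := Complex.hasSum_taylorSeries_on_ball (c := 0) (r := r) (z := (hH.eigenvalues i : ℂ))
    (hg.mono ball_subset_closedBall) (by simpa using h.norm_eigenvalue_lt hH hr i)
  refine this.congr_fun fun n => ?_
  simp only [sub_zero, smul_eq_mul]
  ring

end Spectral

end PMR

/-! ### Assembly of the estimators -/

theorem mainTheorem7 {Ω : Type*} [Fintype Ω] [DecidableEq Ω] [Nonempty Ω]
    (G : Subgroup (Equiv.Perm Ω)) [Fintype G] (D : G → Ω → ℂ) (H : Matrix Ω Ω ℂ)
    (hH : H.IsHermitian) (hPMR : PMR.IsPMRForm G D H) (β : ℝ) (hβ : 0 < β) :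
    -- the partition function is the sum of the weights, and no estimator divides by zero
    ((PMR.gibbs β H).trace ≠ 0 ∧
      HasSum (fun c : PMR.Config G => c.weight β D) (PMR.gibbs β H).trace ∧
      ∀ c : PMR.Config G, c.boltz β D 0 c.q ≠ 0) ∧
    -- functions of `H`
    (∀ (r : ℝ) (g : ℂ → ℂ), (∀ x, ∑ y, ‖H x y‖ < r) →
      AnalyticOnNhd ℂ g (Metric.closedBall 0 r) →
      Summable (PMR.taylorTerm g H) ∧
      HasSum (fun c : PMR.Config G => c.hopping D *
          ∑ j ∈ Finset.range (c.q + 1),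
            PMR.dividedDifference r g (c.energies D j c.q) * c.boltz β D 0 j)
        (PMR.matFun g H * PMR.gibbs β H).trace ∧
      PMR.IsEstimator β D H (PMR.matFun g H) (PMR.Config.estFun β D r g)) ∧
    -- powers of `H`
    PMR.IsEstimator β D H H (PMR.Config.estH β D) ∧
    (∀ k : ℕ, PMR.IsEstimator β D H (H ^ k) (PMR.Config.estPow β D k)) ∧
    PMR.IsEstimator β D H (H ^ 2) (PMR.Config.estSq β D) ∧
    PMR.IsEstimator β D H (H ^ 3) (PMR.Config.estCube β D) ∧
    -- the off-diagonal part of `H`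
    PMR.IsEstimator β D H (H - Matrix.diagonal (D 1)) (PMR.Config.estOff β D) ∧
    PMR.IsEstimator β D H ((H - Matrix.diagonal (D 1)) ^ 2) (PMR.Config.estOffSq β D) := by
  have hne := hPMR.boltz_ne_zero hH hβ
  have h1 : PMR.Config.estPow β D 1 = PMR.Config.estH β D :=
    funext fun c => PMR.Config.estPow_one (hne c)
  have h2 : PMR.Config.estPow β D 2 = PMR.Config.estSq β D :=
    funext fun c => PMR.Config.estPow_two (hne c)
  have h3 : PMR.Config.estPow β D 3 = PMR.Config.estCube β D :=
    funext fun c => PMR.Config.estPow_three (hne c)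
  have h0 := hPMR.estPow_zero hH hβ
  -- The walk is closed, so `E_{z_q}` depends on the initial state only and can be produced by the
  -- weight `w`.
  have hE : ∀ c : PMR.Config G, c.energy D c.q = D 1 c.z := fun c => by
    rw [PMR.Config.energy, c.state_q]
  have hpow := hPMR.isEstimator_pow hH hβ
  refine ⟨⟨PMR.gibbs_trace_ne_zero hH β, hPMR.hasSum_weight hH hβ, hne⟩, ?_, ?_, hpow, h2 ▸ hpow 2,
    h3 ▸ hpow 3, ?_, ?_⟩
  · intro r g hr hg
    have hgd := hg.differentiableOn
    have hT := hPMR.hasSum_taylorTerm hH hr hgd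
    rw [PMR.matFun, hT.tsum_eq]
    exact ⟨hT.summable, by simpa using hPMR.hasSum_hopping hH hr β hgd fun _ => 1,
      hPMR.isEstimator hH hβ (by simpa using hPMR.hasSum_estFun hH hr hβ hgd fun _ => 1)⟩
  · simpa [h1] using hpow 1
  · refine hPMR.isEstimator hH hβ ?_
    have a1 := hPMR.hasSum_estPow hH hβ 1 fun _ => 1
    -- The expansion of `Tr[D_0 e^{-βH}]`, to be subtracted from that of `Tr[H e^{-βH}]`.
    have a0 := hPMR.hasSum_estPow hH hβ 0 (D 1)
    simp only [h1, h0, Matrix.diagonal_one, one_mul, mul_one, pow_one,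
      pow_zero] at a0 a1
    rw [Matrix.sub_mul, Matrix.trace_sub]
    refine (a1.sub a0).congr_fun fun c => ?_
    rw [PMR.Config.estOff, PMR.Config.estH, hE]
    ring
  · refine hPMR.isEstimator hH hβ ?_
    have a2 := hPMR.hasSum_estPow hH hβ 2 fun _ => 1
    have a1 := hPMR.hasSum_estPow hH hβ 1 (D 1)
    have a0 := hPMR.hasSum_estPow hH hβ 0 (fun z => D 1 z * D 1 z)
    simp only [h1, h2, h0, Matrix.diagonal_one, one_mul, mul_one, pow_one,
      pow_zero, ← Matrix.diagonal_mul_diagonal] at a0 a1 a2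
    -- `H` commutes with the Gibbs operator, so cyclicity of the trace makes the two cross terms of
    -- the square equal; hence the factor `2`.
    have hcomm : (H * Matrix.diagonal (D 1) * PMR.gibbs β H).trace =
        (Matrix.diagonal (D 1) * (H * PMR.gibbs β H)).trace := by
      rw [PMR.gibbs_eq_spectralFun hH, PMR.commute_spectralFun, Matrix.mul_assoc,
        Matrix.trace_mul_comm, Matrix.mul_assoc]
    have htr : ((H - Matrix.diagonal (D 1)) ^ 2 * PMR.gibbs β H).trace =
        (H ^ 2 * PMR.gibbs β H).trace +
          (Matrix.diagonal (D 1) * Matrix.diagonal (D 1) * PMR.gibbs β H).trace -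
          2 * (Matrix.diagonal (D 1) * (H * PMR.gibbs β H)).trace := by
      have : (H - Matrix.diagonal (D 1)) ^ 2 * PMR.gibbs β H = H ^ 2 * PMR.gibbs β H +
          Matrix.diagonal (D 1) * Matrix.diagonal (D 1) * PMR.gibbs β H -
          H * Matrix.diagonal (D 1) * PMR.gibbs β H -
          Matrix.diagonal (D 1) * (H * PMR.gibbs β H) := by noncomm_ring
      rw [this, Matrix.trace_sub, Matrix.trace_sub, Matrix.trace_add, hcomm]
      ring
    rw [htr]
    refine ((a2.add a0).sub (a1.mul_left 2)).congr_fun fun c => ?_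
    rw [PMR.Config.estOffSq, hE]
    ring
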